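/- Let $\pi:E\to M$ be a smooth fibre bundle with $\dim M=n$ and $k$-dimensional typical fibre, so $\dim E=n+k$. Indices $i,j$ run over $1,\dots,n$ and $A,B$ over $1,\dots,k$. An adapted frame at $e\in E$ is a basis $(e_i,e_A)$ of $T_eE$ with $\pi_*(e)(e_A)=0$ for all $A$; the adapted frames form the adapted frame bundle $L_\pi E\to E$, a principal bundle with structure group $$G_V=\left\{\begin{pmatrix}A&0\\ C&B\end{pmatrix}: A\in GL(n,\mathbb R),\ B\in GL(k,\mathbb R),\ C\in\mathbb R^{k\times n}\right\},\qquad (e_i,e_A)\begin{pmatrix}A&0\\ C&B\end{pmatrix}=(A^i_je_i+C^A_je_A,\ B^A_Be_A).$$ Let $H\cong GL(n,\mathbb R)\times GL(k,\mathbb R)$ be the subgroup $C=0$ of $G_V$. Each coset in $G_V/H$ has a unique representative $\begin{pmatrix}I&0\\ \xi&I\end{pmatrix}$; this identifies $G_V/H$ with $\mathbb R^{kn}$, and gives $G_V/H$ a $G_V$-invariant affine structure modelled on $\mathbb R^{kn}$, on which $G_V$ acts by $\xi\mapsto CA^{-1}+B\xi A^{-1}$. Let $L_\pi E\times_{G_V}(G_V/H)\to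 E$ be the associated bundle, whose points are the classes $[u,x]$ with $[ug,x]=[u,gx]$; its local trivializations are $[s(e),\xi]\mapsto(e,\xi)$ for the smooth local sections $s$ of $L_\pi E$, and its fibre over $e$ carries the affine structure for which $x\mapsto[u,x]$ is affine for every frame $u$ at $e$ (modelled on the fibre of $L_\pi E\times_{G_V}\mathbb R^{kn}$, where $G_V$ acts by $v\mapsto BvA^{-1}$). Let $J^1\pi\to E$ be the bundle whose fibre over $e$ is the set of linear maps $\tau:T_{\pi(e)}M\to T_eE$ with $\pi_*(e)\circ\tau=\mathrm{id}$, an affine space modelled on the linear maps $T_{\pi(e)}M\to\ker\pi_*(e)$, with the smooth structure given by the standard jet coordinates $(x^i,y^A,y^A_i)$ of adapted coordinates $(x^i,y^A)$ on $E$. Theorem. Both $L_\pi E\times_{G_V}(G_V/H)$ and $J^1\pi$ are smooth affine bundles over $E$, and there is an isomorphism of smooth affine bundles over $\mathrm{id}_E$ (a diffeomorphism which restricts to an affine isomorphism on each fibre) $$L_\pi E\times_{G_V}(G_V/H)\;\cong\;J^1\pi$$ which sends the class $[(e_i,e_A)_e,\xi]$, for $\xi=(\xi^A_i)\in\mathbb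 R^{kn}\cong G_V/H$, to the linear map $T_{\pi(e)}M\to T_eE$ determined by $\pi_*(e)(e_i)\mapsto e_i+\xi^A_i\,e_A$ for $i=1,\dots,n$. -/

import Mathlib

open scoped Manifold ContDiff Matrix MatrixGroups
open Bundle

noncomputable section

/-! ### The structure group `G_V`, the subgroup `H` and the homogeneous space `G_V / H` -/

/-- The group `G_V` of nonsingular block lower triangular matrices `[A 0; C B]`,
with `A ∈ GL(n, ℝ)`, `B ∈ GL(k, ℝ)` and `C` an arbitrary `k × n` matrix. -/
def blockLowerTriangular (n k : ℕ) : Subgroup (GL (Fin n ⊕ Fin k) ℝ) where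
  carrier := {g | ∃ (A : GL (Fin n) ℝ) (C : Matrix (Fin k) (Fin n) ℝ) (B : GL (Fin k) ℝ),
    (g : Matrix (Fin n ⊕ Fin k) (Fin n ⊕ Fin k) ℝ) = Matrix.fromBlocks A.1 0 C B.1}
  one_mem' := ⟨1, 0, 1, by simp⟩
  mul_mem' := by
    rintro g g' ⟨A, C, B, h⟩ ⟨A', C', B', h'⟩
    exact ⟨A * A', C * A'.1 + B.1 * C', B * B', by
      simp [h, h', Matrix.fromBlocks_multiply]⟩
  inv_mem' := by
    rintro g ⟨A, C, B, h⟩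
    refine ⟨A⁻¹, -((B⁻¹).1 * C * (A⁻¹).1), B⁻¹, ?_⟩
    have key : Matrix.fromBlocks (A⁻¹).1 0 (-((B⁻¹).1 * C * (A⁻¹).1)) (B⁻¹).1 * g.1 = 1 := by
      rw [h, Matrix.fromBlocks_multiply, ← Matrix.fromBlocks_one]
      congr 1
      · simp
      · simp
      · simp [Matrix.mul_assoc]
      · simp
    exact Units.inv_eq_of_mul_eq_one_left key

/-- `G_V` as a group in its own right. -/
abbrev GV (n k : ℕ) : Type := blockLowerTriangular n k

namespace GV

variable {n k : ℕ}

/-- The block `A` of `[A 0; C B]`. -/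
def A (g : GV n k) : Matrix (Fin n) (Fin n) ℝ := g.1.1.toBlocks₁₁
/-- The block `C` of `[A 0; C B]`. -/
def C (g : GV n k) : Matrix (Fin k) (Fin n) ℝ := g.1.1.toBlocks₂₁
/-- The block `B` of `[A 0; C B]`. -/
def B (g : GV n k) : Matrix (Fin k) (Fin k) ℝ := g.1.1.toBlocks₂₂

theorem val_eq (g : GV n k) : g.1.1 = Matrix.fromBlocks g.A 0 g.C g.B := by
  obtain ⟨A, C, B, h⟩ := g.2
  simp [GV.A, GV.C, GV.B, h]

theorem isUnit_A (g : GV n k) : IsUnit g.A := by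
  obtain ⟨A, C, B, h⟩ := g.2
  simp [GV.A, h]

theorem isUnit_B (g : GV n k) : IsUnit g.B := by
  obtain ⟨A, C, B, h⟩ := g.2
  simp [GV.B, h]

theorem isUnit_det_A (g : GV n k) : IsUnit g.A.det := (Matrix.isUnit_iff_isUnit_det _).1 g.isUnit_A

@[simp] theorem A_one : (1 : GV n k).A = 1 := by
  simp [GV.A, ← Matrix.fromBlocks_one]
@[simp] theorem C_one : (1 : GV n k).C = 0 := by
  simp [GV.C, ← Matrix.fromBlocks_one]
@[simp] theorem B_one : (1 : GV n k).B = 1 := by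
  simp [GV.B, ← Matrix.fromBlocks_one]

theorem val_mul (g h : GV n k) : (g * h).1.1 =
    Matrix.fromBlocks (g.A * h.A) 0 (g.C * h.A + g.B * h.C) (g.B * h.B) := by
  change g.1.1 * h.1.1 = _
  rw [val_eq g, val_eq h, Matrix.fromBlocks_multiply]
  simp

theorem A_mul (g h : GV n k) : (g * h).A = g.A * h.A := by
  rw [GV.A, val_mul, Matrix.toBlocks_fromBlocks₁₁]
theorem C_mul (g h : GV n k) : (g * h).C = g.C * h.A + g.B * h.C := by
  rw [GV.C, val_mul, Matrix.toBlocks_fromBlocks₂₁]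
theorem B_mul (g h : GV n k) : (g * h).B = g.B * h.B := by
  rw [GV.B, val_mul, Matrix.toBlocks_fromBlocks₂₂]

/-- The subgroup `H ≅ GL(n) × GL(k)` of block diagonal matrices in `G_V`. -/
def H (n k : ℕ) : Subgroup (GV n k) where
  carrier := {g | ∃ (A : GL (Fin n) ℝ) (B : GL (Fin k) ℝ),
    (g.1 : Matrix (Fin n ⊕ Fin k) (Fin n ⊕ Fin k) ℝ) = Matrix.fromBlocks A.1 0 0 B.1}
  one_mem' := ⟨1, 1, by simp⟩
  mul_mem' := by
    rintro g g' ⟨A, B, h⟩ ⟨A', B', h'⟩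
    exact ⟨A * A', B * B', by simp [h, h', Matrix.fromBlocks_multiply]⟩
  inv_mem' := by
    rintro g ⟨A, B, h⟩
    refine ⟨A⁻¹, B⁻¹, ?_⟩
    have key : Matrix.fromBlocks (A⁻¹).1 0 0 (B⁻¹).1 * g.1.1 = 1 := by
      rw [h, Matrix.fromBlocks_multiply, ← Matrix.fromBlocks_one]
      simp
    exact Units.inv_eq_of_mul_eq_one_left key

theorem mem_H_iff {g : GV n k} : g ∈ H n k ↔ g.C = 0 := by
  constructor
  · rintro ⟨A, B, h⟩
    simp [GV.C, h]
  · intro h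
    exact ⟨g.isUnit_A.unit, g.isUnit_B.unit, by rw [g.val_eq, h]; rfl⟩

/-- The representative `[I 0; ξ I]` attached to a `k × n` matrix `ξ`. -/
def unip (ξ : Matrix (Fin k) (Fin n) ℝ) : GV n k :=
  ⟨⟨Matrix.fromBlocks 1 0 ξ 1, Matrix.fromBlocks 1 0 (-ξ) 1,
      by simp [Matrix.fromBlocks_multiply], by simp [Matrix.fromBlocks_multiply]⟩,
    1, ξ, 1, by simp⟩

@[simp] theorem A_unip (ξ : Matrix (Fin k) (Fin n) ℝ) : (unip ξ).A = 1 := by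
  simp [unip, GV.A]
@[simp] theorem C_unip (ξ : Matrix (Fin k) (Fin n) ℝ) : (unip ξ).C = ξ := by
  simp [unip, GV.C]
@[simp] theorem B_unip (ξ : Matrix (Fin k) (Fin n) ℝ) : (unip ξ).B = 1 := by
  simp [unip, GV.B]

end GV

/-- The homogeneous space `G_V / H` of left cosets. -/
abbrev HomogeneousSpace (n k : ℕ) : Type := GV n k ⧸ GV.H n k

instance (n k : ℕ) : MulAction (GV n k) (HomogeneousSpace n k) :=
  inferInstanceAs (MulAction (GV n k) (GV n k ⧸ GV.H n k))

namespace HomogeneousSpace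

variable {n k : ℕ}

/-- The identification `G_V / H ≃ ℝ^{kn}`: the coset of `[A 0; C B]` has the unique
representative of the form `[I 0; ξ I]`, namely with `ξ = C A⁻¹`. -/
def coord (n k : ℕ) : HomogeneousSpace n k ≃ Matrix (Fin k) (Fin n) ℝ where
  toFun := Quotient.lift (fun g : GV n k => g.C * g.A⁻¹) (by
    intro a b hab
    have hH : a⁻¹ * b ∈ GV.H n k := QuotientGroup.leftRel_apply.1 hab
    obtain ⟨h, rfl⟩ : ∃ h, b = a * h := ⟨a⁻¹ * b, by group⟩
    rw [inv_mul_cancel_left, GV.mem_H_iff] at hH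
    simp only [GV.C_mul, GV.A_mul, hH, Matrix.mul_zero, add_zero, Matrix.mul_inv_rev]
    rw [← Matrix.mul_assoc, Matrix.mul_nonsing_inv_cancel_right _ _ h.isUnit_det_A])
  invFun ξ := (GV.unip ξ : GV n k)
  left_inv := by
    intro x
    induction x using Quotient.inductionOn with
    | h g =>
      refine (QuotientGroup.eq (s := GV.H n k)).2 ?_
      rw [GV.mem_H_iff]
      set ξ := g.C * g.A⁻¹ with hξ
      have h1 : GV.unip ξ * ((GV.unip ξ)⁻¹ * g) = g := by group
      have h2 := congrArg GV.C h1
      have h3 := congrArg GV.A h1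
      rw [GV.C_mul, GV.C_unip, GV.B_unip, Matrix.one_mul] at h2
      rw [GV.A_mul, GV.A_unip, Matrix.one_mul] at h3
      rw [h3, hξ, Matrix.mul_assoc, Matrix.nonsing_inv_mul _ g.isUnit_det_A, Matrix.mul_one] at h2
      simpa using h2
  right_inv ξ := by
    change (GV.unip ξ).C * (GV.unip ξ).A⁻¹ = ξ
    simp

@[simp] theorem coord_mk (g : GV n k) : coord n k (g : HomogeneousSpace n k) = g.C * g.A⁻¹ := rfl

@[simp] theorem coord_symm (ξ : Matrix (Fin k) (Fin n) ℝ) :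
    (coord n k).symm ξ = (GV.unip ξ : HomogeneousSpace n k) := rfl

/-- The left action is `g • (a H) = (g a) H`. -/
theorem smul_mk (g a : GV n k) :
    g • (a : HomogeneousSpace n k) = ((g * a : GV n k) : HomogeneousSpace n k) := rfl

/-- The left action of `G_V` on `G_V / H` reads `ξ ↦ C A⁻¹ + B ξ A⁻¹`. -/
theorem coord_smul (g : GV n k) (x : HomogeneousSpace n k) :
    coord n k (g • x) = g.C * g.A⁻¹ + g.B * coord n k x * g.A⁻¹ := by
  induction x using Quotient.inductionOn with
  | h a =>
    change coord n k ((g * a : GV n k) : HomogeneousSpace n k) = _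
    change _ = g.C * g.A⁻¹ + g.B * (a.C * a.A⁻¹) * g.A⁻¹
    rw [coord_mk, GV.C_mul, GV.A_mul, Matrix.mul_inv_rev, Matrix.add_mul, ← Matrix.mul_assoc,
      ← Matrix.mul_assoc, Matrix.mul_nonsing_inv_cancel_right _ _ a.isUnit_det_A]
    simp only [Matrix.mul_assoc]

/-- The affine structure of `G_V / H`, modelled on `ℝ^{kn}`, obtained from the identification
`G_V / H ≃ ℝ^{kn}`. -/
instance : AddTorsor (Matrix (Fin k) (Fin n) ℝ) (HomogeneousSpace n k) where
  vadd v x := (coord n k).symm (v + coord n k x)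
  zero_vadd x := by
    change (coord n k).symm (0 + coord n k x) = x
    rw [zero_add, Equiv.symm_apply_apply]
  add_vadd v w x := by
    change (coord n k).symm (v + w + coord n k x)
      = (coord n k).symm (v + coord n k ((coord n k).symm (w + coord n k x)))
    rw [Equiv.apply_symm_apply, add_assoc]
  vsub x y := coord n k x - coord n k y
  nonempty := ⟨(1 : GV n k)⟩
  vsub_vadd' x y := by
    change (coord n k).symm (coord n k x - coord n k y + coord n k y) = x
    rw [sub_add_cancel, Equiv.symm_apply_apply]
  vadd_vsub' v x := by
    change coord n k ((coord n k).symm (v + coord n k x)) - coord n k x = v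
    rw [Equiv.apply_symm_apply, add_sub_cancel_right]

theorem coord_vadd (v : Matrix (Fin k) (Fin n) ℝ) (x : HomogeneousSpace n k) :
    coord n k (v +ᵥ x) = v + coord n k x := (coord n k).apply_symm_apply _

theorem vsub_eq (x y : HomogeneousSpace n k) : x -ᵥ y = coord n k x - coord n k y := rfl

end HomogeneousSpace

/-- The linear action `v ↦ B v A⁻¹` of `G_V` on `ℝ^{kn}`, the linear part of its action
on `G_V / H`. -/
instance GV.linearAction {n k : ℕ} : DistribMulAction (GV n k) (Matrix (Fin k) (Fin n) ℝ) where
  smul g v := g.B * v * g.A⁻¹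
  one_smul v := by
    change (1 : GV n k).B * v * (1 : GV n k).A⁻¹ = v
    simp
  mul_smul g h v := by
    change (g * h).B * v * (g * h).A⁻¹ = g.B * (h.B * v * h.A⁻¹) * g.A⁻¹
    rw [GV.B_mul, GV.A_mul, Matrix.mul_inv_rev]
    simp only [Matrix.mul_assoc]
  smul_zero g := by
    change g.B * 0 * g.A⁻¹ = 0
    simp
  smul_add g v w := by
    change g.B * (v + w) * g.A⁻¹ = g.B * v * g.A⁻¹ + g.B * w * g.A⁻¹
    rw [Matrix.mul_add, Matrix.add_mul]

theorem GV.linear_smul_def {n k : ℕ} (g : GV n k) (v : Matrix (Fin k) (Fin n) ℝ) :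
    g • v = g.B * v * g.A⁻¹ := rfl

/-- The affine structure of `G_V / H` is `G_V`-invariant. -/
theorem HomogeneousSpace.smul_vadd {n k : ℕ} (g : GV n k) (v : Matrix (Fin k) (Fin n) ℝ)
    (x : HomogeneousSpace n k) : g • (v +ᵥ x) = (g • v) +ᵥ (g • x) := by
  apply (HomogeneousSpace.coord n k).injective
  rw [coord_smul, coord_vadd, coord_vadd, coord_smul, GV.linear_smul_def, Matrix.mul_add,
    Matrix.add_mul]
  abel

theorem GV.linear_smul_smul {n k : ℕ} (g : GV n k) (c : ℝ) (v : Matrix (Fin k) (Fin n) ℝ) :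
    g • (c • v) = c • (g • v) := by
  simp [GV.linear_smul_def]

/-! ### Smooth fibre bundles and adapted charts -/

section Bundles

variable {n k : ℕ} {M E F : Type*}
  [TopologicalSpace M] [ChartedSpace (EuclideanSpace ℝ (Fin n)) M]
  [TopologicalSpace E] [ChartedSpace (EuclideanSpace ℝ (Fin (n + k))) E]
  [TopologicalSpace F] [ChartedSpace (EuclideanSpace ℝ (Fin k)) F]

/-- A smooth fibre bundle `π : E → M` with typical fibre `F`, where `dim M = n`, `dim F = k`
and `dim E = n + k`. -/
structure SmoothFiberBundle (n k : ℕ) (M E F : Type*)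
    [TopologicalSpace M] [ChartedSpace (EuclideanSpace ℝ (Fin n)) M]
    [TopologicalSpace E] [ChartedSpace (EuclideanSpace ℝ (Fin (n + k))) E]
    [TopologicalSpace F] [ChartedSpace (EuclideanSpace ℝ (Fin k)) F] where
  /-- The projection of the bundle. -/
  proj : E → M
  /-- Around every point of the base there is a smooth local trivialization
  `π⁻¹(U) ≅ U × F` over `U`. -/
  exists_trivialization (x : M) : ∃ t : Bundle.Trivialization F proj, x ∈ t.baseSet ∧
    ContMDiffOn (𝓡 (n + k)) ((𝓡 n).prod (𝓡 k)) ∞ t t.source ∧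
    ContMDiffOn ((𝓡 n).prod (𝓡 k)) (𝓡 (n + k)) ∞ t.toOpenPartialHomeomorph.symm t.target


namespace SmoothFiberBundle

variable (p : SmoothFiberBundle n k M E F)

/-- The tangent map `π_*(e) : T_e E → T_{π(e)} M`. -/
abbrev tangentMapAt (e : E) :
    TangentSpace (𝓡 (n + k)) e →L[ℝ] TangentSpace (𝓡 n) (p.proj e) :=
  mfderiv (𝓡 (n + k)) (𝓡 n) p.proj e

/-- Adapted coordinates `(x^i, y^A)` on an open subset of `E`: a smooth chart `(x, y)` of `E`
together with a smooth chart of `M` in which `π` reads `(x, y) ↦ x`. -/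
structure AdaptedChart where
  /-- The chart `(x, y)` of the total space. -/
  total : OpenPartialHomeomorph E (EuclideanSpace ℝ (Fin n) × EuclideanSpace ℝ (Fin k))
  /-- The chart `x` of the base. -/
  base : OpenPartialHomeomorph M (EuclideanSpace ℝ (Fin n))
  contMDiffOn_total : ContMDiffOn (𝓡 (n + k))
    𝓘(ℝ, EuclideanSpace ℝ (Fin n) × EuclideanSpace ℝ (Fin k)) ∞ total total.source
  contMDiffOn_total_symm :
    ContMDiffOn 𝓘(ℝ, EuclideanSpace ℝ (Fin n) × EuclideanSpace ℝ (Fin k)) (𝓡 (n + k)) ∞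
      total.symm total.target
  contMDiffOn_base : ContMDiffOn (𝓡 n) (𝓡 n) ∞ base base.source
  contMDiffOn_base_symm : ContMDiffOn (𝓡 n) (𝓡 n) ∞ base.symm base.target
  mapsTo_proj : Set.MapsTo p.proj total.source base.source
  base_proj : ∀ e ∈ total.source, base (p.proj e) = (total e).1

theorem exists_adaptedChart [IsManifold (𝓡 n) ∞ M] [IsManifold (𝓡 k) ∞ F] (e : E) :
    ∃ c : p.AdaptedChart, e ∈ c.total.source := by
  obtain ⟨t, hx, ht, ht'⟩ := p.exists_trivialization (p.proj e)
  have he : e ∈ t.source := t.mem_source.2 hx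
  let b := chartAt (EuclideanSpace ℝ (Fin n)) (p.proj e)
  let f := chartAt (EuclideanSpace ℝ (Fin k)) (t e).2
  have hb : ContMDiffOn (𝓡 n) (𝓡 n) ∞ b b.source := contMDiffOn_chart
  have hf : ContMDiffOn (𝓡 k) (𝓡 k) ∞ f f.source := contMDiffOn_chart
  have hb' : ContMDiffOn (𝓡 n) (𝓡 n) ∞ b.symm b.target := contMDiffOn_chart_symm
  have hf' : ContMDiffOn (𝓡 k) (𝓡 k) ∞ f.symm f.target := contMDiffOn_chart_symm
  have hsrc : ∀ e' ∈ (t.toOpenPartialHomeomorph.trans (b.prod f)).source,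
      e' ∈ t.source ∧ p.proj e' ∈ b.source ∧ (t e').2 ∈ f.source := by
    intro e' he'
    have h1 : e' ∈ t.source := he'.1
    have h2 : t e' ∈ b.source ×ˢ f.source := he'.2
    refine ⟨h1, ?_, h2.2⟩
    rw [← t.coe_fst h1]
    exact h2.1
  refine ⟨⟨t.toOpenPartialHomeomorph.trans (b.prod f), b, ?_, ?_, hb, hb', ?_, ?_⟩, ?_⟩
  · have h := ContMDiffOn.comp (t := b.source ×ˢ f.source) (s := (t.toOpenPartialHomeomorph.trans
      (b.prod f)).source) (hb.prodMap hf) (ht.mono fun e' he' => (hsrc e' he').1)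
      (fun e' he' => he'.2)
    rw [modelWithCornersSelf_prod, ← chartedSpaceSelf_prod]
    exact h
  · have h := ContMDiffOn.comp (t := t.target) (s := (t.toOpenPartialHomeomorph.trans
      (b.prod f)).target) ht' ((hb'.prodMap hf').mono fun q hq => hq.1) (fun q hq => hq.2)
    rw [modelWithCornersSelf_prod, ← chartedSpaceSelf_prod]
    exact h
  · intro e' he'
    exact (hsrc e' he').2.1
  · intro e' he'
    change b (p.proj e') = b (t e').1
    rw [t.coe_fst (hsrc e' he').1]
  · refine ⟨he, ?_⟩
    change t e ∈ b.source ×ˢ f.source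
    refine ⟨?_, mem_chart_source _ _⟩
    rw [t.coe_fst he]
    exact mem_chart_source _ _

namespace AdaptedChart

variable {p} (c : p.AdaptedChart)

/-- The standard basis of `ℝ^n × ℝ^k`. -/
def stdBasis (n k : ℕ) :
    Module.Basis (Fin n ⊕ Fin k) ℝ (EuclideanSpace ℝ (Fin n) × EuclideanSpace ℝ (Fin k)) :=
  (EuclideanSpace.basisFun (Fin n) ℝ).toBasis.prod (EuclideanSpace.basisFun (Fin k) ℝ).toBasis

/-- The coordinate vector fields `∂/∂x^i` and `∂/∂y^A` of an adapted chart. -/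
def coordVec (α : Fin n ⊕ Fin k) (e : E) : TangentSpace (𝓡 (n + k)) e :=
  mfderiv 𝓘(ℝ, EuclideanSpace ℝ (Fin n) × EuclideanSpace ℝ (Fin k)) (𝓡 (n + k)) c.total.symm
    (c.total e) (stdBasis n k α)

end AdaptedChart

/-- An adapted frame `(e_i, e_A)` at `e ∈ E`: a basis of `T_e E` whose last `k` vectors are
vertical. -/
@[ext]
structure AdaptedFrame (e : E) where
  /-- The underlying basis; `inl i` stands for the index `i` and `inr A` for the index `A`. -/
  basis : Module.Basis (Fin n ⊕ Fin k) ℝ (TangentSpace (𝓡 (n + k)) e)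
  vertical : ∀ A : Fin k, p.tangentMapAt e (basis (Sum.inr A)) = 0

/-- A smooth local section `e ↦ (e_i, e_A)_e` of the adapted frame bundle over an open set. -/
structure LocalAdaptedFrame [IsManifold (𝓡 (n + k)) ∞ E] where
  /-- The vector fields making up the frame. -/
  vec : Fin n ⊕ Fin k → (e : E) → TangentSpace (𝓡 (n + k)) e
  /-- The domain of the section. -/
  domain : Set E
  isOpen_domain : IsOpen domain
  isLocalFrameOn :
    IsLocalFrameOn (𝓡 (n + k)) (EuclideanSpace ℝ (Fin (n + k))) ∞ vec domain
  vertical : ∀ e ∈ domain, ∀ A : Fin k, p.tangentMapAt e (vec (Sum.inr A) e) = 0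

namespace AdaptedChart

variable {p} (c : p.AdaptedChart)

theorem mdifferentiable : c.total.MDifferentiable (𝓡 (n + k))
    𝓘(ℝ, EuclideanSpace ℝ (Fin n) × EuclideanSpace ℝ (Fin k)) :=
  ⟨c.contMDiffOn_total.mdifferentiableOn (by simp),
    c.contMDiffOn_total_symm.mdifferentiableOn (by simp)⟩

/-- The basis of `T_e E` formed by the coordinate vectors of an adapted chart. -/
def coordBasis {e : E} (he : e ∈ c.total.source) :
    Module.Basis (Fin n ⊕ Fin k) ℝ (TangentSpace (𝓡 (n + k)) e) :=
  (stdBasis n k).map (c.mdifferentiable.mfderiv he).symm.toLinearEquiv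

theorem coordBasis_apply {e : E} (he : e ∈ c.total.source) (α : Fin n ⊕ Fin k) :
    c.coordBasis he α = c.coordVec α e := rfl

theorem proj_symm {q : EuclideanSpace ℝ (Fin n) × EuclideanSpace ℝ (Fin k)}
    (hq : q ∈ c.total.target) : p.proj (c.total.symm q) = c.base.symm q.1 := by
  have h := c.base_proj _ (c.total.map_target hq)
  rw [c.total.right_inv hq] at h
  rw [← h, c.base.left_inv (c.mapsTo_proj (c.total.map_target hq))]

theorem hasMFDerivAt_proj {e : E} (he : e ∈ c.total.source) :
    HasMFDerivAt (𝓡 (n + k)) (𝓡 n) p.proj e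
      (((mfderiv (𝓡 n) (𝓡 n) c.base.symm (c.total e).1).comp
        (ContinuousLinearMap.fst ℝ (EuclideanSpace ℝ (Fin n)) (EuclideanSpace ℝ (Fin k)))).comp
        (mfderiv (𝓡 (n + k)) 𝓘(ℝ, EuclideanSpace ℝ (Fin n) × EuclideanSpace ℝ (Fin k))
          c.total e)) := by
  have h1 : HasMFDerivAt (𝓡 (n + k)) 𝓘(ℝ, EuclideanSpace ℝ (Fin n) × EuclideanSpace ℝ (Fin k))
      c.total e (mfderiv (𝓡 (n + k)) 𝓘(ℝ, EuclideanSpace ℝ (Fin n) × EuclideanSpace ℝ (Fin k))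
          c.total e) :=
    ((c.contMDiffOn_total.contMDiffAt (c.total.open_source.mem_nhds he)).mdifferentiableAt
      (by simp)).hasMFDerivAt
  have h2 : HasMFDerivAt 𝓘(ℝ, EuclideanSpace ℝ (Fin n) × EuclideanSpace ℝ (Fin k)) (𝓡 n)
      (Prod.fst : EuclideanSpace ℝ (Fin n) × EuclideanSpace ℝ (Fin k) → _) (c.total e)
      (ContinuousLinearMap.fst ℝ (EuclideanSpace ℝ (Fin n)) (EuclideanSpace ℝ (Fin k))) :=
    (ContinuousLinearMap.fst ℝ (EuclideanSpace ℝ (Fin n)) (EuclideanSpace ℝ (Fin k))).hasMFDerivAt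
  have hb : (c.total e).1 ∈ c.base.target := by
    rw [← c.base_proj e he]
    exact c.base.map_source (c.mapsTo_proj he)
  have h3 : HasMFDerivAt (𝓡 n) (𝓡 n) c.base.symm (c.total e).1
      (mfderiv (𝓡 n) (𝓡 n) c.base.symm (c.total e).1) :=
    ((c.contMDiffOn_base_symm.contMDiffAt (c.base.open_target.mem_nhds hb)).mdifferentiableAt
      (by simp)).hasMFDerivAt
  refine ((h3.comp (c.total e) h2).comp e h1).congr_of_eventuallyEq ?_
  filter_upwards [c.total.open_source.mem_nhds he] with e' he'
  have := c.proj_symm (c.total.map_source he')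
  rw [c.total.left_inv he'] at this
  exact this

theorem tangentMapAt_symm {e : E} (he : e ∈ c.total.source)
    (v : EuclideanSpace ℝ (Fin n) × EuclideanSpace ℝ (Fin k)) :
    p.tangentMapAt e ((c.mdifferentiable.mfderiv he).symm v) =
    mfderiv (𝓡 n) (𝓡 n) c.base.symm (c.total e).1 v.1 := by
  have h : mfderiv (𝓡 (n + k)) 𝓘(ℝ, EuclideanSpace ℝ (Fin n) × EuclideanSpace ℝ (Fin k))
      c.total e ((c.mdifferentiable.mfderiv he).symm v) = v :=
    (c.mdifferentiable.mfderiv he).apply_symm_apply v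
  rw [tangentMapAt, (c.hasMFDerivAt_proj he).mfderiv]
  exact congrArg (fun w => mfderiv (𝓡 n) (𝓡 n) c.base.symm (c.total e).1
    (ContinuousLinearMap.fst ℝ (EuclideanSpace ℝ (Fin n)) (EuclideanSpace ℝ (Fin k)) w)) h

theorem tangentMapAt_coordVec_inr {e : E} (he : e ∈ c.total.source) (A : Fin k) :
    p.tangentMapAt e (c.coordVec (Sum.inr A) e) = 0 := by
  refine (c.tangentMapAt_symm he (stdBasis n k (Sum.inr A))).trans ?_
  have : (stdBasis n k (Sum.inr A)).1 = 0 := by simp [stdBasis]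
  exact (congrArg _ this).trans (map_zero _)

theorem surjective_tangentMapAt {e : E} (he : e ∈ c.total.source) :
    Function.Surjective (p.tangentMapAt e) := by
  have hb : (c.total e).1 ∈ c.base.target := by
    rw [← c.base_proj e he]
    exact c.base.map_source (c.mapsTo_proj he)
  have hB : c.base.symm.MDifferentiable (𝓡 n) (𝓡 n) :=
    ⟨c.contMDiffOn_base_symm.mdifferentiableOn (by simp),
      c.contMDiffOn_base.mdifferentiableOn (by simp)⟩
  intro w
  obtain ⟨v, hv⟩ := (hB.mfderiv hb).surjective w
  exact ⟨(c.mdifferentiable.mfderiv he).symm (v, (0 : EuclideanSpace ℝ (Fin k))),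
    (c.tangentMapAt_symm he _).trans hv⟩

theorem contMDiffOn_coordVec [IsManifold (𝓡 (n + k)) ∞ E] (α : Fin n ⊕ Fin k) :
    ContMDiffOn (𝓡 (n + k)) ((𝓡 (n + k)).prod 𝓘(ℝ, EuclideanSpace ℝ (Fin (n + k)))) ∞
      (fun e => (⟨e, c.coordVec α e⟩ : TangentBundle (𝓡 (n + k)) E)) c.total.source := by
  have h := c.contMDiffOn_total_symm.contMDiffOn_tangentMapWithin (m := ∞) (by simp)
    c.total.open_target.uniqueMDiffOn
  have h2 : ContMDiffOn (𝓡 (n + k))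
      (𝓘(ℝ, EuclideanSpace ℝ (Fin n) × EuclideanSpace ℝ (Fin k)).tangent) ∞
      (fun e => (⟨c.total e, stdBasis n k α⟩ :
        TangentBundle 𝓘(ℝ, EuclideanSpace ℝ (Fin n) × EuclideanSpace ℝ (Fin k))
        (EuclideanSpace ℝ (Fin n) × EuclideanSpace ℝ (Fin k)))) c.total.source :=
    (contMDiff_vectorSpace_iff_contDiff (V := fun _ => stdBasis n k α) |>.2
      contDiff_const).comp_contMDiffOn c.contMDiffOn_total
  refine (h.comp h2 ?_).congr ?_
  · intro e he
    exact c.total.map_source he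
  · intro e he
    refine Bundle.TotalSpace.ext (c.total.left_inv he).symm (heq_of_eq ?_)
    have := mfderivWithin_of_isOpen (f := c.total.symm) (I := 𝓘(ℝ, EuclideanSpace ℝ (Fin n) × EuclideanSpace ℝ (Fin k))) (I' := 𝓡 (n + k)) c.total.open_target (c.total.map_source he)
    exact (DFunLike.congr_fun this (stdBasis n k α)).symm

/-- The coordinate frame `(∂/∂x^i, ∂/∂y^A)` of an adapted chart. -/
def frame [IsManifold (𝓡 n) ∞ M] [IsManifold (𝓡 (n + k)) ∞ E] :
    p.LocalAdaptedFrame where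
  vec := c.coordVec
  domain := c.total.source
  isOpen_domain := c.total.open_source
  isLocalFrameOn :=
    { linearIndependent := fun he => (c.coordBasis he).linearIndependent
      generating := fun he => (c.coordBasis he).span_eq.ge
      contMDiffOn := c.contMDiffOn_coordVec }
  vertical _ he A := c.tangentMapAt_coordVec_inr he A

end AdaptedChart

theorem surjective_tangentMapAt [IsManifold (𝓡 n) ∞ M] [IsManifold (𝓡 k) ∞ F] (e : E) :
    Function.Surjective (p.tangentMapAt e) := by
  obtain ⟨c, hc⟩ := p.exists_adaptedChart e
  exact c.surjective_tangentMapAt hc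

/-! ### The adapted frame bundle and its structure group -/

namespace AdaptedFrame

variable {p} {e : E}

instance [IsManifold (𝓡 n) ∞ M] [IsManifold (𝓡 k) ∞ F] : Nonempty (p.AdaptedFrame e) := by
  obtain ⟨c, hc⟩ := p.exists_adaptedChart e
  exact ⟨⟨c.coordBasis hc, fun A => c.tangentMapAt_coordVec_inr hc A⟩⟩

/-- The right action of `G_V` on adapted frames,
`(e_i, e_A) · [A 0; C B] = (A^i_j e_i + C^A_j e_A, B^A_B e_A)`. -/
def act (u : p.AdaptedFrame e) (g : GV n k) : p.AdaptedFrame e where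
  basis := u.basis.map (Matrix.toLinearEquiv u.basis g.1.1
    ((Matrix.isUnit_iff_isUnit_det _).1 g.1.isUnit))
  vertical A := by
    rw [Module.Basis.map_apply, Matrix.toLinearEquiv_apply, Matrix.toLin_self, g.val_eq, map_sum]
    refine Finset.sum_eq_zero fun α _ => ?_
    cases α with
    | inl i => simp
    | inr B => rw [map_smul, u.vertical, smul_zero]

theorem act_basis (u : p.AdaptedFrame e) (g : GV n k) (β : Fin n ⊕ Fin k) :
    (u.act g).basis β = ∑ α, g.1.1 α β • u.basis α := by
  rw [act, Module.Basis.map_apply, Matrix.toLinearEquiv_apply, Matrix.toLin_self]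

theorem act_basis_inl (u : p.AdaptedFrame e) (g : GV n k) (j : Fin n) :
    (u.act g).basis (Sum.inl j) =
      ∑ i, g.A i j • u.basis (Sum.inl i) + ∑ A, g.C A j • u.basis (Sum.inr A) := by
  rw [act_basis, Fintype.sum_sum_type, g.val_eq]
  rfl

theorem act_basis_inr (u : p.AdaptedFrame e) (g : GV n k) (B : Fin k) :
    (u.act g).basis (Sum.inr B) = ∑ A, g.B A B • u.basis (Sum.inr A) := by
  rw [act_basis, Fintype.sum_sum_type, g.val_eq]
  simp

theorem ext_basis {u u' : p.AdaptedFrame e} (h : ∀ α, u.basis α = u'.basis α) : u = u' :=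
  AdaptedFrame.ext (Module.Basis.eq_of_apply_eq h)

@[simp] theorem act_one (u : p.AdaptedFrame e) : u.act 1 = u := by
  refine ext_basis fun β => ?_
  rw [act_basis]
  change ∑ α, (1 : Matrix (Fin n ⊕ Fin k) (Fin n ⊕ Fin k) ℝ) α β • u.basis α = _
  simp [Matrix.one_apply]

theorem act_mul (u : p.AdaptedFrame e) (g h : GV n k) : u.act (g * h) = (u.act g).act h := by
  refine ext_basis fun β => ?_
  rw [act_basis, act_basis]
  simp only [act_basis, Finset.smul_sum, smul_smul]
  change ∑ α, (g.1.1 * h.1.1) α β • u.basis α = _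
  simp only [Matrix.mul_apply, Finset.sum_smul]
  rw [Finset.sum_comm]
  simp only [mul_comm]

theorem act_injective (u : p.AdaptedFrame e) : Function.Injective u.act := by
  intro g h hgh
  refine Subtype.ext (Units.ext ?_)
  ext α β
  have h1 := congrArg (fun v : p.AdaptedFrame e => u.basis.repr (v.basis β) α) hgh
  simpa [act_basis, Finsupp.single_apply, -Fintype.sum_sum_type] using h1

variable [IsManifold (𝓡 n) ∞ M] [IsManifold (𝓡 k) ∞ F]

/-- The basis `ê_i = π_*(e)(e_i)` of `T_{π(e)} M` induced by an adapted frame. -/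
def baseBasis (u : p.AdaptedFrame e) :
    Module.Basis (Fin n) ℝ (TangentSpace (𝓡 n) (p.proj e)) :=
  basisOfTopLeSpanOfCardEqFinrank (fun i => p.tangentMapAt e (u.basis (Sum.inl i)))
    (by
      intro w _
      obtain ⟨v, rfl⟩ := p.surjective_tangentMapAt e w
      rw [← u.basis.sum_repr v, map_sum, Fintype.sum_sum_type]
      simp only [map_smul, u.vertical, smul_zero, Finset.sum_const_zero, add_zero]
      exact Submodule.sum_mem _ fun i _ =>
        Submodule.smul_mem _ _ (Submodule.subset_span ⟨i, rfl⟩))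
    (by
      rw [Fintype.card_fin]
      exact (finrank_euclideanSpace_fin (𝕜 := ℝ) (n := n)).symm)

@[simp] theorem baseBasis_apply (u : p.AdaptedFrame e) (i : Fin n) :
    u.baseBasis i = p.tangentMapAt e (u.basis (Sum.inl i)) := by
  simp [baseBasis]

theorem baseBasis_repr (u : p.AdaptedFrame e) (v : TangentSpace (𝓡 (n + k)) e) (i : Fin n) :
    u.baseBasis.repr (p.tangentMapAt e v) i = u.basis.repr v (Sum.inl i) := by
  conv_lhs => rw [← u.basis.sum_repr v]
  rw [map_sum, Fintype.sum_sum_type]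
  simp only [map_smul, u.vertical, smul_zero, Finset.sum_const_zero, add_zero, ← baseBasis_apply]
  simp [Finsupp.single_apply, -baseBasis_apply]

/-- `G_V` acts transitively on the adapted frames at a point. -/
theorem exists_act_eq (u u' : p.AdaptedFrame e) : ∃ g : GV n k, u' = u.act g := by
  let T := u.basis.toMatrix u'.basis
  let T' := u'.basis.toMatrix u.basis
  have h1 : T * T' = 1 := Module.Basis.toMatrix_mul_toMatrix_flip _ _
  have h2 : T' * T = 1 := Module.Basis.toMatrix_mul_toMatrix_flip _ _
  have h12 : T.toBlocks₁₂ = 0 := by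
    ext i A
    change u.basis.repr (u'.basis (Sum.inr A)) (Sum.inl i) = 0
    rw [← baseBasis_repr, u'.vertical, map_zero]
    rfl
  have hT : T = Matrix.fromBlocks T.toBlocks₁₁ 0 T.toBlocks₂₁ T.toBlocks₂₂ := by
    rw [← h12, Matrix.fromBlocks_toBlocks]
  have hdet : IsUnit (T.toBlocks₁₁.det * T.toBlocks₂₂.det) := by
    rw [← Matrix.det_fromBlocks_zero₁₂, ← hT]
    exact (Matrix.isUnit_iff_isUnit_det _).1 ⟨⟨T, T', h1, h2⟩, rfl⟩
  obtain ⟨hA, hB⟩ := IsUnit.mul_iff.1 hdet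
  refine ⟨⟨⟨T, T', h1, h2⟩, ((Matrix.isUnit_iff_isUnit_det _).2 hA).unit, T.toBlocks₂₁,
    ((Matrix.isUnit_iff_isUnit_det _).2 hB).unit, hT⟩, ?_⟩
  refine ext_basis fun β => ?_
  rw [act_basis]
  exact (u.basis.sum_toMatrix_smul_self u'.basis β).symm

end AdaptedFrame

/-! ### Fibres of associated bundles -/

/-- The equivalence relation `(u, x) ∼ (u g, g⁻¹ x)` on `(L_π E)_e × X`, for a left
`G_V`-space `X`. -/
def associatedSetoid (e : E) (X : Type*) [MulAction (GV n k) X] :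
    Setoid (p.AdaptedFrame e × X) where
  r a b := ∃ g : GV n k, b.1 = a.1.act g ∧ b.2 = g⁻¹ • a.2
  iseqv :=
    { refl := fun a => ⟨1, by simp, by simp⟩
      symm := by
        rintro a b ⟨g, h1, h2⟩
        exact ⟨g⁻¹, by rw [h1, ← AdaptedFrame.act_mul, mul_inv_cancel, AdaptedFrame.act_one],
          by rw [h2, inv_inv, smul_inv_smul]⟩
      trans := by
        rintro a b c ⟨g, h1, h2⟩ ⟨h, h3, h4⟩
        exact ⟨g * h, by rw [h3, h1, AdaptedFrame.act_mul], by rw [h4, h2, mul_inv_rev, mul_smul]⟩ }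

/-- The fibre at `e` of the associated bundle `L_π E ×_{G_V} X`. -/
def Associated (e : E) (X : Type*) [MulAction (GV n k) X] : Type _ :=
  Quotient (p.associatedSetoid e X)

namespace Associated

variable {p} {e : E} {X : Type*} [MulAction (GV n k) X]

/-- The class `[u, x]`. -/
def mk (u : p.AdaptedFrame e) (x : X) : p.Associated e X :=
  Quotient.mk (p.associatedSetoid e X) (u, x)

theorem mk_act (u : p.AdaptedFrame e) (g : GV n k) (x : X) :
    mk (u.act g) x = mk u (g • x) :=
  (Quotient.sound (s := p.associatedSetoid e X) ⟨g, rfl, (inv_smul_smul g x).symm⟩).symm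

variable [IsManifold (𝓡 n) ∞ M] [IsManifold (𝓡 k) ∞ F]

theorem mk_bijective (u : p.AdaptedFrame e) :
    Function.Bijective (mk u : X → p.Associated e X) := by
  constructor
  · intro x y hxy
    obtain ⟨g, h1, h2⟩ := Quotient.exact (s := p.associatedSetoid e X) hxy
    have : g = 1 := u.act_injective (by rw [← h1, AdaptedFrame.act_one])
    rw [this] at h2
    simpa using h2.symm
  · intro a
    induction a using Quotient.inductionOn with
    | h a =>
      obtain ⟨g, hg⟩ := u.exists_act_eq a.1
      exact ⟨g • a.2, by rw [← mk_act, ← hg]; rfl⟩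

/-- The identification of the fibre of an associated bundle with `X` given by a frame `u`,
`[u, x] ↦ x`. -/
def coord (u : p.AdaptedFrame e) : p.Associated e X ≃ X :=
  (Equiv.ofBijective (mk u) (mk_bijective u)).symm

@[simp] theorem coord_mk (u : p.AdaptedFrame e) (x : X) : coord u (mk u x) = x :=
  (Equiv.ofBijective (mk u) (mk_bijective u)).symm_apply_apply x

@[simp] theorem mk_coord (u : p.AdaptedFrame e) (a : p.Associated e X) : mk u (coord u a) = a :=
  (Equiv.ofBijective (mk u) (mk_bijective u)).apply_symm_apply a

theorem coord_symm (u : p.AdaptedFrame e) (x : X) : (coord u).symm x = mk u x := rfl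

theorem coord_act (u : p.AdaptedFrame e) (g : GV n k) (a : p.Associated e X) :
    coord u a = g • coord (u.act g) a := by
  conv_lhs => rw [← mk_coord (u.act g) a, mk_act, coord_mk]

end Associated

variable [IsManifold (𝓡 n) ∞ M] [IsManifold (𝓡 k) ∞ F]

/-- The fibre at `e` of the vector bundle `L_π E ×_{G_V} ℝ^{kn}`. -/
abbrev AssociatedDirection (e : E) : Type := p.Associated e (Matrix (Fin k) (Fin n) ℝ)

/-- The fibre at `e` of the bundle `L_π E ×_{G_V} (G_V / H)`. -/
abbrev AssociatedHomogeneous (e : E) : Type := p.Associated e (HomogeneousSpace n k)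

/-- The linear structure on the fibres of `L_π E ×_{G_V} ℝ^{kn}`: transported along
`v ↦ [u, v]`, for any frame `u`. -/
instance (e : E) : AddCommGroup (p.AssociatedDirection e) :=
  (Associated.coord (Classical.arbitrary (p.AdaptedFrame e))).addCommGroup

instance (e : E) : Module ℝ (p.AssociatedDirection e) :=
  (Associated.coord (Classical.arbitrary (p.AdaptedFrame e))).module ℝ

/-- The affine structure on the fibres of `L_π E ×_{G_V} (G_V / H)`: transported along
`x ↦ [u, x]`, for any frame `u`. -/
instance (e : E) : AddTorsor (p.AssociatedDirection e) (p.AssociatedHomogeneous e) :=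
  let u := Classical.arbitrary (p.AdaptedFrame e)
  let c : p.AssociatedDirection e ≃ Matrix (Fin k) (Fin n) ℝ := Associated.coord u
  let d : p.AssociatedHomogeneous e ≃ HomogeneousSpace n k := Associated.coord u
  { vadd := fun v x => d.symm (c v +ᵥ d x)
    zero_vadd := fun x => by
      change d.symm (c (c.symm 0) +ᵥ d x) = x
      rw [Equiv.apply_symm_apply, zero_vadd, Equiv.symm_apply_apply]
    add_vadd := fun v w x => by
      change d.symm (c (c.symm (c v + c w)) +ᵥ d x) = d.symm (c v +ᵥ d (d.symm (c w +ᵥ d x)))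
      rw [Equiv.apply_symm_apply, Equiv.apply_symm_apply, add_vadd]
    vsub := fun x y => c.symm (d x -ᵥ d y)
    nonempty := ⟨d.symm (Classical.arbitrary _)⟩
    vsub_vadd' := fun x y => by
      change d.symm (c (c.symm (d x -ᵥ d y)) +ᵥ d y) = x
      rw [Equiv.apply_symm_apply, vsub_vadd, Equiv.symm_apply_apply]
    vadd_vsub' := fun v x => by
      change c.symm (d (d.symm (c v +ᵥ d x)) -ᵥ d x) = v
      rw [Equiv.apply_symm_apply, vadd_vsub, Equiv.symm_apply_apply] }

namespace Associated

variable {p} {e : E}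

/-- Addition in the fibres of `L_π E ×_{G_V} ℝ^{kn}` does not depend on the frame. -/
theorem mk_add (u : p.AdaptedFrame e) (v w : Matrix (Fin k) (Fin n) ℝ) :
    (mk u (v + w) : p.AssociatedDirection e) = mk u v + mk u w := by
  obtain ⟨g, hg⟩ := (Classical.arbitrary (p.AdaptedFrame e)).exists_act_eq u
  rw [hg, mk_act, mk_act, mk_act]
  change _ = (coord (Classical.arbitrary (p.AdaptedFrame e))).symm
    (coord _ (mk _ _) + coord _ (mk _ _))
  rw [coord_mk, coord_mk, coord_symm, smul_add]

/-- Scalar multiplication in the fibres of `L_π E ×_{G_V} ℝ^{kn}` does not depend on the frame. -/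
theorem mk_smul (u : p.AdaptedFrame e) (r : ℝ) (v : Matrix (Fin k) (Fin n) ℝ) :
    (mk u (r • v) : p.AssociatedDirection e) = r • mk u v := by
  obtain ⟨g, hg⟩ := (Classical.arbitrary (p.AdaptedFrame e)).exists_act_eq u
  rw [hg, mk_act, mk_act]
  change _ = (coord (Classical.arbitrary (p.AdaptedFrame e))).symm (r • coord _ (mk _ _))
  rw [coord_mk, coord_symm, GV.linear_smul_smul]

/-- The affine structure of the fibres of `L_π E ×_{G_V} (G_V / H)` does not depend on the
frame. -/
theorem mk_vadd (u : p.AdaptedFrame e) (v : Matrix (Fin k) (Fin n) ℝ) (x : HomogeneousSpace n k) :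
    (mk u (v +ᵥ x) : p.AssociatedHomogeneous e) =
      (mk u v : p.AssociatedDirection e) +ᵥ (mk u x : p.AssociatedHomogeneous e) := by
  obtain ⟨g, hg⟩ := (Classical.arbitrary (p.AdaptedFrame e)).exists_act_eq u
  rw [hg, mk_act, mk_act, mk_act]
  change _ = (coord (Classical.arbitrary (p.AdaptedFrame e))).symm
    (coord _ (mk _ _) +ᵥ coord _ (mk _ _))
  rw [coord_mk, coord_mk, coord_symm, HomogeneousSpace.smul_vadd]

/-- The coordinate `ξ` of the class `[u, ξ]` with respect to a frame `u`. -/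
def matrixCoord (u : p.AdaptedFrame e) : p.AssociatedHomogeneous e ≃ Matrix (Fin k) (Fin n) ℝ :=
  (coord u).trans (HomogeneousSpace.coord n k)

theorem matrixCoord_act (u : p.AdaptedFrame e) (g : GV n k) (a : p.AssociatedHomogeneous e) :
    matrixCoord u a = g.C * g.A⁻¹ + g.B * matrixCoord (u.act g) a * g.A⁻¹ := by
  change HomogeneousSpace.coord n k (coord u a) = _
  rw [coord_act u g, HomogeneousSpace.coord_smul]
  rfl

end Associated

/-! ### First jets -/

/-- The fibre of `J¹π` at `e`: the linear right inverses `τ : T_{π(e)} M → T_e E` of `π_*(e)`. -/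
@[ext]
structure Jet (e : E) where
  /-- The underlying linear map. -/
  toLin : TangentSpace (𝓡 n) (p.proj e) →L[ℝ] TangentSpace (𝓡 (n + k)) e
  tangentMapAt_apply (w : TangentSpace (𝓡 n) (p.proj e)) : p.tangentMapAt e (toLin w) = w

/-- The fibre at `e` of the vector bundle on which `J¹π → E` is modelled: the linear maps
`T_{π(e)} M → T_e E` with vertical values. -/
def JetDirection (e : E) :
    Submodule ℝ (TangentSpace (𝓡 n) (p.proj e) →L[ℝ] TangentSpace (𝓡 (n + k)) e) where
  carrier := {σ | ∀ w, p.tangentMapAt e (σ w) = 0}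
  add_mem' := by
    intro σ σ' h h' w
    change p.tangentMapAt e (σ w + σ' w) = 0
    rw [map_add, h, h', add_zero]
  zero_mem' := fun _ => map_zero _
  smul_mem' := by
    intro c σ h w
    change p.tangentMapAt e (c • σ w) = 0
    rw [map_smul, h, smul_zero]

namespace Jet

variable {p} {e : E}

/-- The jet `τ` with `τ(π_* e_i) = e_i + ξ^A_i e_A`. -/
def ofCoord (u : p.AdaptedFrame e) (ξ : Matrix (Fin k) (Fin n) ℝ) : p.Jet e :=
  haveI : FiniteDimensional ℝ (TangentSpace (𝓡 n) (p.proj e)) :=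
    inferInstanceAs (FiniteDimensional ℝ (EuclideanSpace ℝ (Fin n)))
  haveI : T2Space (TangentSpace (𝓡 n) (p.proj e)) :=
    inferInstanceAs (T2Space (EuclideanSpace ℝ (Fin n)))
  { toLin := LinearMap.toContinuousLinearMap
      (u.baseBasis.constr ℝ fun i => u.basis (Sum.inl i) + ∑ A, ξ A i • u.basis (Sum.inr A))
    tangentMapAt_apply := by
      refine LinearMap.congr_fun (f := (p.tangentMapAt e).toLinearMap ∘ₗ
        (u.baseBasis.constr ℝ fun i => u.basis (Sum.inl i) + ∑ A, ξ A i • u.basis (Sum.inr A)))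
        (g := LinearMap.id) (u.baseBasis.ext fun i => ?_)
      change p.tangentMapAt e (u.baseBasis.constr ℝ
        (fun i => u.basis (Sum.inl i) + ∑ A, ξ A i • u.basis (Sum.inr A)) (u.baseBasis i)) =
        u.baseBasis i
      rw [Module.Basis.constr_basis, map_add, map_sum]
      simp only [map_smul, u.vertical, smul_zero, Finset.sum_const_zero, add_zero,
        AdaptedFrame.baseBasis_apply] }

theorem ofCoord_apply (u : p.AdaptedFrame e) (ξ : Matrix (Fin k) (Fin n) ℝ) (i : Fin n) :
    (ofCoord u ξ).toLin (p.tangentMapAt e (u.basis (Sum.inl i))) =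
      u.basis (Sum.inl i) + ∑ A, ξ A i • u.basis (Sum.inr A) := by
  rw [← AdaptedFrame.baseBasis_apply]
  exact Module.Basis.constr_basis u.baseBasis ℝ _ i

/-- The coordinates `ξ^A_i` of a jet `τ` with respect to an adapted frame, defined by
`τ(π_* e_i) = e_i + ξ^A_i e_A`. For the coordinate frame of an adapted chart these are the
standard jet coordinates `y^A_i`. -/
def matrixCoord (u : p.AdaptedFrame e) : p.Jet e ≃ Matrix (Fin k) (Fin n) ℝ where
  toFun τ := Matrix.of fun A i =>
    u.basis.repr (τ.toLin (p.tangentMapAt e (u.basis (Sum.inl i)))) (Sum.inr A)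
  invFun ξ := ofCoord u ξ
  left_inv τ := by
    refine Jet.ext (ContinuousLinearMap.coe_injective (u.baseBasis.ext fun i => ?_))
    change (ofCoord u _).toLin (u.baseBasis i) = τ.toLin (u.baseBasis i)
    rw [AdaptedFrame.baseBasis_apply, ofCoord_apply]
    conv_rhs => rw [← u.basis.sum_repr (τ.toLin _), Fintype.sum_sum_type]
    simp only [← AdaptedFrame.baseBasis_repr, tangentMapAt_apply, Matrix.of_apply]
    congr 1
    simp only [← AdaptedFrame.baseBasis_apply, Module.Basis.repr_self]
    simp [Finsupp.single_apply, -AdaptedFrame.baseBasis_apply]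
  right_inv ξ := by
    ext A i
    change u.basis.repr ((ofCoord u ξ).toLin (p.tangentMapAt e (u.basis (Sum.inl i)))) (Sum.inr A) =
      ξ A i
    rw [ofCoord_apply]
    simp [Finsupp.single_apply]

theorem apply_eq (u : p.AdaptedFrame e) (τ : p.Jet e) (i : Fin n) :
    τ.toLin (p.tangentMapAt e (u.basis (Sum.inl i))) =
      u.basis (Sum.inl i) + ∑ A, matrixCoord u τ A i • u.basis (Sum.inr A) := by
  conv_lhs => rw [← (matrixCoord u).symm_apply_apply τ]
  exact ofCoord_apply u _ i

theorem matrixCoord_act (u : p.AdaptedFrame e) (g : GV n k) (τ : p.Jet e) :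
    matrixCoord u τ = g.C * g.A⁻¹ + g.B * matrixCoord (u.act g) τ * g.A⁻¹ := by
  have key : matrixCoord u τ * g.A = g.C + g.B * matrixCoord (u.act g) τ := by
    ext B j
    have h := apply_eq (u.act g) τ j
    have h2 := congrArg (fun v => u.basis.repr v (Sum.inr B)) h
    simp only [AdaptedFrame.act_basis_inl, AdaptedFrame.act_basis_inr, map_add, map_sum, map_smul,
      u.vertical, apply_eq] at h2
    simp only [Matrix.mul_apply, Matrix.add_apply]
    simpa [Finsupp.single_apply, Finset.sum_apply, mul_comm] using h2
  rw [← Matrix.add_mul, ← key, Matrix.mul_nonsing_inv_cancel_right _ _ g.isUnit_det_A]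

/-- The affine structure of the fibres of `J¹π → E`. -/
instance : AddTorsor (p.JetDirection e) (p.Jet e) where
  vadd σ τ := ⟨σ.1 + τ.toLin, fun w => by
    change p.tangentMapAt e (σ.1 w + τ.toLin w) = w
    rw [map_add, σ.2 w, τ.tangentMapAt_apply, zero_add]⟩
  zero_vadd τ := Jet.ext (zero_add _)
  add_vadd σ σ' τ := Jet.ext (add_assoc _ _ _)
  vsub τ τ' := ⟨τ.toLin - τ'.toLin, fun w => by
    change p.tangentMapAt e (τ.toLin w - τ'.toLin w) = 0
    rw [map_sub, τ.tangentMapAt_apply, τ'.tangentMapAt_apply, sub_self]⟩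
  nonempty := ⟨ofCoord (Classical.arbitrary (p.AdaptedFrame e)) 0⟩
  vsub_vadd' τ τ' := Jet.ext (sub_add_cancel _ _)
  vadd_vsub' σ τ := Subtype.ext (add_sub_cancel_right _ _)

end Jet

/-! ### Topology and smooth structure of the bundles over `E` -/

variable [IsManifold (𝓡 (n + k)) ∞ E]

namespace LocalAdaptedFrame

variable {p} (s s' : p.LocalAdaptedFrame)

open Classical in
/-- The value at `e` of a local section of the adapted frame bundle (and an arbitrary adapted
frame if `e` is not in the domain). -/
def frameAt (e : E) : p.AdaptedFrame e :=
  if he : e ∈ s.domain then ⟨s.isLocalFrameOn.toBasisAt he, fun A => by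
    rw [IsLocalFrameOn.toBasisAt_coe]; exact s.vertical e he A⟩
  else Classical.arbitrary _

theorem frameAt_basis {e : E} (he : e ∈ s.domain) (α : Fin n ⊕ Fin k) :
    (s.frameAt e).basis α = s.vec α e := by
  rw [frameAt, dif_pos he]
  exact s.isLocalFrameOn.toBasisAt_coe he α

/-- The transition function between two local sections of the adapted frame bundle. -/
def transition (e : E) : GV n k := Classical.choose ((s.frameAt e).exists_act_eq (s'.frameAt e))

theorem act_transition (e : E) : (s.frameAt e).act (s.transition s' e) = s'.frameAt e :=
  (Classical.choose_spec ((s.frameAt e).exists_act_eq (s'.frameAt e))).symm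

theorem continuousOn_transition :
    ContinuousOn (fun e => (s.transition s' e).1.1) (s.domain ∩ s'.domain) := by
  intro e₀ he₀
  let t := trivializationAt (EuclideanSpace ℝ (Fin (n + k)))
    (TangentSpace (𝓡 (n + k)) : E → Type _) e₀
  have inst : MemTrivializationAtlas t := inferInstance
  let b : Module.Basis (Fin (n + k)) ℝ (EuclideanSpace ℝ (Fin (n + k))) :=
    (EuclideanSpace.basisFun (Fin (n + k)) ℝ).toBasis
  let b' : Module.Basis (Fin n ⊕ Fin k) ℝ (EuclideanSpace ℝ (Fin (n + k))) :=
    b.reindex finSumFinEquiv.symm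
  have ht : e₀ ∈ t.baseSet := FiberBundle.mem_baseSet_trivializationAt (EuclideanSpace ℝ (Fin (n + k)))
    (TangentSpace (𝓡 (n + k)) : E → Type _) e₀
  let mat (r : p.LocalAdaptedFrame) (e : E) : Matrix (Fin n ⊕ Fin k) (Fin n ⊕ Fin k) ℝ :=
    Matrix.of fun α β => b'.repr (t ⟨e, r.vec β e⟩).2 α
  have hcont : ∀ (r : p.LocalAdaptedFrame), e₀ ∈ r.domain → ContinuousAt (mat r) e₀ := by
    intro r hr
    refine continuousAt_pi.2 fun α => continuousAt_pi.2 fun β => ?_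
    have h1 : ContinuousAt (fun e => (⟨e, r.vec β e⟩ : TangentBundle (𝓡 (n + k)) E)) e₀ :=
      ((r.isLocalFrameOn.contMDiffOn β).continuousOn).continuousAt (r.isOpen_domain.mem_nhds hr)
    have h2 : ContinuousAt (fun e => (t ⟨e, r.vec β e⟩).2) e₀ :=
      continuous_snd.continuousAt.comp
        (ContinuousAt.comp (g := t) (t.continuousAt (t.mem_source.2 ht)) h1)
    exact (LinearMap.continuous_of_finiteDimensional (b'.coord α)).continuousAt.comp h2
  have hmul : ∀ e ∈ t.baseSet, e ∈ s.domain → e ∈ s'.domain →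
      mat s' e = mat s e * (s.transition s' e).1.1 := by
    intro e he hs hs'
    ext α β
    have h := congrArg (fun u : p.AdaptedFrame e => u.basis β) (s.act_transition s' e)
    simp only [AdaptedFrame.act_basis, frameAt_basis _ hs, frameAt_basis _ hs'] at h
    have h2 := congrArg (fun v => b'.repr (t.continuousLinearEquivAt ℝ e he v) α) h
    simp only [map_sum, map_smul, Finsupp.coe_finsetSum, Finset.sum_apply, Finsupp.smul_apply,
      smul_eq_mul] at h2
    rw [Matrix.mul_apply]
    refine h2.symm.trans (Finset.sum_congr rfl fun γ _ => mul_comm _ _)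
  have hdet : ∀ e ∈ t.baseSet, e ∈ s.domain → IsUnit (mat s e).det := by
    intro e he hs
    let c := (s.isLocalFrameOn.toBasisAt hs).map (t.continuousLinearEquivAt ℝ e he).toLinearEquiv
    have hc : mat s e = b'.toMatrix c := by
      ext α β
      change _ = b'.repr (t.continuousLinearEquivAt ℝ e he (s.isLocalFrameOn.toBasisAt hs β)) α
      rw [IsLocalFrameOn.toBasisAt_coe]
      rfl
    rw [hc]
    have := b'.invertibleToMatrix c
    exact (Matrix.isUnit_iff_isUnit_det _).1 (isUnit_of_invertible _)
  have hev : ∀ᶠ e in nhds e₀, (mat s e)⁻¹ * mat s' e = (s.transition s' e).1.1 := by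
    filter_upwards [t.open_baseSet.mem_nhds ht, s.isOpen_domain.mem_nhds he₀.1,
      s'.isOpen_domain.mem_nhds he₀.2] with e h1 h2 h3
    rw [hmul e h1 h2 h3, Matrix.nonsing_inv_mul_cancel_left _ _ (hdet e h1 h2)]
  refine (ContinuousAt.congr ?_ hev).continuousWithinAt
  have hmat : ContinuousAt (fun e => ((mat s e).det)⁻¹ • (mat s e).adjugate * mat s' e) e₀ := by
    have h1 := hcont s he₀.1
    have h2 := hcont s' he₀.2
    have h3 : ContinuousAt (fun e => (mat s e).det) e₀ :=
      (continuous_id.matrix_det).continuousAt.comp h1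
    have h4 : ContinuousAt (fun e => (mat s e).adjugate) e₀ :=
      (continuous_id.matrix_adjugate).continuousAt.comp h1
    have h5 := (h3.inv₀ (hdet e₀ ht he₀.1).ne_zero).smul h4
    have h6 : Continuous (fun q : Matrix (Fin n ⊕ Fin k) (Fin n ⊕ Fin k) ℝ ×
        Matrix (Fin n ⊕ Fin k) (Fin n ⊕ Fin k) ℝ => q.1 * q.2) :=
      continuous_fst.matrix_mul continuous_snd
    exact (h6.tendsto _).comp (h5.tendsto.prodMk_nhds h2.tendsto)
  simpa only [Matrix.inv_def, Ring.inverse_eq_inv'] using hmat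

end LocalAdaptedFrame

/-- Given identifications `c u` of `A e` with `ℝ^{kn}`, one for each adapted frame `u` at `e`,
a local section `s` of the adapted frame bundle over `U` yields the bijection
`A|_U ≃ U × ℝ^{kn}`, `a ↦ (e, c (s e) a)`. -/
def pretrivialization {A : E → Type*}
    (c : ∀ {e : E}, p.AdaptedFrame e → A e ≃ Matrix (Fin k) (Fin n) ℝ)
    (s : p.LocalAdaptedFrame) :
    Pretrivialization (Fin k → Fin n → ℝ) (π (Fin k → Fin n → ℝ) A) where
  toFun a := (a.1, Matrix.of.symm (c (s.frameAt a.1) a.2))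
  invFun q := ⟨q.1, (c (s.frameAt q.1)).symm (Matrix.of q.2)⟩
  source := TotalSpace.proj ⁻¹' s.domain
  target := s.domain ×ˢ Set.univ
  map_source' a ha := ⟨ha, trivial⟩
  map_target' q hq := hq.1
  left_inv' a _ := by simp
  right_inv' q _ := by simp
  open_target := s.isOpen_domain.prod isOpen_univ
  baseSet := s.domain
  open_baseSet := s.isOpen_domain
  source_eq := rfl
  target_eq := rfl
  proj_toFun _ _ := rfl

/-- The fibre bundle with fibres `A e` and typical fibre `ℝ^{kn}` whose topology is determined
by the local trivializations attached to a family of local sections of the adapted frame bundle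
covering `E`. -/
def prebundle {A : E → Type*} [∀ e, TopologicalSpace (A e)]
    (c : ∀ {e : E}, p.AdaptedFrame e → A e ≃ Matrix (Fin k) (Fin n) ℝ)
    (hc : ∀ {e : E} (u : p.AdaptedFrame e) (g : GV n k) (a : A e),
      c u a = g.C * g.A⁻¹ + g.B * c (u.act g) a * g.A⁻¹)
    {ι : Type*} (fr : ι → p.LocalAdaptedFrame) (ix : E → ι)
    (hix : ∀ e, e ∈ (fr (ix e)).domain)
    (hind : ∀ e, Topology.IsInducing fun a : A e => Matrix.of.symm (c ((fr (ix e)).frameAt e) a)) :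
    FiberPrebundle (Fin k → Fin n → ℝ) A where
  pretrivializationAtlas := Set.range fun i => p.pretrivialization c (fr i)
  pretrivializationAt e := p.pretrivialization c (fr (ix e))
  mem_base_pretrivializationAt := hix
  pretrivialization_mem_atlas e := ⟨ix e, rfl⟩
  continuous_trivChange := by
    rintro _ ⟨i, rfl⟩ _ ⟨j, rfl⟩
    have hdom : ∀ q ∈ (p.pretrivialization c (fr j)).target ∩
        (p.pretrivialization c (fr j)).toPartialEquiv.symm ⁻¹'
          (p.pretrivialization c (fr i)).source, q.1 ∈ (fr i).domain ∩ (fr j).domain :=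
      fun q hq => ⟨hq.2, hq.1.1⟩
    have hT : ContinuousOn (fun q : E × (Fin k → Fin n → ℝ) =>
        ((fr i).transition (fr j) q.1).1.1) ((p.pretrivialization c (fr j)).target ∩
        (p.pretrivialization c (fr j)).toPartialEquiv.symm ⁻¹'
          (p.pretrivialization c (fr i)).source) :=
      ((fr i).continuousOn_transition (fr j)).comp continuous_fst.continuousOn hdom
    have h11 : Continuous fun m : Matrix (Fin n ⊕ Fin k) (Fin n ⊕ Fin k) ℝ => m.toBlocks₁₁ :=
      continuous_id.matrix_submatrix Sum.inl Sum.inl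
    have h21 : Continuous fun m : Matrix (Fin n ⊕ Fin k) (Fin n ⊕ Fin k) ℝ => m.toBlocks₂₁ :=
      continuous_id.matrix_submatrix Sum.inr Sum.inl
    have h22 : Continuous fun m : Matrix (Fin n ⊕ Fin k) (Fin n ⊕ Fin k) ℝ => m.toBlocks₂₂ :=
      continuous_id.matrix_submatrix Sum.inr Sum.inr
    have hA := h11.comp_continuousOn hT
    have hC := h21.comp_continuousOn hT
    have hB := h22.comp_continuousOn hT
    have hAi : ContinuousOn (fun q : E × (Fin k → Fin n → ℝ) =>
        (((fr i).transition (fr j) q.1).A)⁻¹) ((p.pretrivialization c (fr j)).target ∩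
        (p.pretrivialization c (fr j)).toPartialEquiv.symm ⁻¹'
          (p.pretrivialization c (fr i)).source) := by
      simp only [Matrix.inv_def, Ring.inverse_eq_inv']
      refine ContinuousOn.smul (ContinuousOn.inv₀
        (continuous_id.matrix_det.comp_continuousOn hA) ?_)
        (continuous_id.matrix_adjugate.comp_continuousOn hA)
      exact fun q _ => (GV.isUnit_det_A _).ne_zero
    have hmul1 : Continuous (fun q : Matrix (Fin k) (Fin n) ℝ × Matrix (Fin n) (Fin n) ℝ =>
      q.1 * q.2) := continuous_fst.matrix_mul continuous_snd
    have hmul2 : Continuous (fun q : Matrix (Fin k) (Fin k) ℝ × Matrix (Fin k) (Fin n) ℝ =>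
      q.1 * q.2) := continuous_fst.matrix_mul continuous_snd
    have hS : ContinuousOn (fun q : E × (Fin k → Fin n → ℝ) => Matrix.of q.2)
        ((p.pretrivialization c (fr j)).target ∩
        (p.pretrivialization c (fr j)).toPartialEquiv.symm ⁻¹'
          (p.pretrivialization c (fr i)).source) := continuous_snd.continuousOn
    refine (continuous_fst.continuousOn.prodMk
      ((hmul1.comp_continuousOn (hC.prodMk hAi)).add (hmul1.comp_continuousOn
        ((hmul2.comp_continuousOn (hB.prodMk hS)).prodMk hAi)))).congr ?_
    intro q hq
    refine Prod.ext rfl ?_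
    change Matrix.of.symm (c ((fr i).frameAt q.1)
      ((c ((fr j).frameAt q.1)).symm (Matrix.of q.2))) = _
    rw [hc _ ((fr i).transition (fr j) q.1), (fr i).act_transition (fr j), Equiv.apply_symm_apply]
    rfl
  totalSpaceMk_isInducing e := by
    exact (isInducing_prodMkRight (Y := Fin k → Fin n → ℝ) e).comp (hind e)

/-- A choice of an adapted chart around each point. -/
def adaptedChartAt (e : E) : p.AdaptedChart := Classical.choose (p.exists_adaptedChart e)

theorem mem_adaptedChartAt_source (e : E) : e ∈ (p.adaptedChartAt e).total.source :=
  Classical.choose_spec (p.exists_adaptedChart e)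

/-! The associated bundle `L_π E ×_{G_V} (G_V / H)`: its local trivializations are
`[s(e), ξ] ↦ (e, ξ)`, for all smooth local sections `s` of `L_π E`. -/

instance (e : E) : TopologicalSpace (p.AssociatedHomogeneous e) :=
  TopologicalSpace.induced
    (fun a => Matrix.of.symm (Associated.matrixCoord ((p.adaptedChartAt e).frame.frameAt e) a))
    inferInstance

/-- The local trivializations of the associated bundle `L_π E ×_{G_V} (G_V / H)`. -/
def associatedPrebundle : FiberPrebundle (Fin k → Fin n → ℝ) p.AssociatedHomogeneous :=
  p.prebundle (fun u => Associated.matrixCoord u) (fun u g a => Associated.matrixCoord_act u g a)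
    id (fun e => (p.adaptedChartAt e).frame) p.mem_adaptedChartAt_source
    (fun _ => Topology.IsInducing.induced _)

instance : TopologicalSpace (TotalSpace (Fin k → Fin n → ℝ) p.AssociatedHomogeneous) :=
  p.associatedPrebundle.totalSpaceTopology

instance : FiberBundle (Fin k → Fin n → ℝ) p.AssociatedHomogeneous :=
  p.associatedPrebundle.toFiberBundle

/-! The jet bundle `J¹π`: its local trivializations are the standard jet coordinates `y^A_i`
of adapted charts. -/

instance (e : E) : TopologicalSpace (p.Jet e) :=
  TopologicalSpace.induced
    (fun τ => Matrix.of.symm (Jet.matrixCoord ((p.adaptedChartAt e).frame.frameAt e) τ))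
    inferInstance

/-- The local trivializations of `J¹π → E`. -/
def jetPrebundle : FiberPrebundle (Fin k → Fin n → ℝ) p.Jet :=
  p.prebundle (fun u => Jet.matrixCoord u) (fun u g a => Jet.matrixCoord_act u g a)
    (fun c : p.AdaptedChart => c.frame) p.adaptedChartAt p.mem_adaptedChartAt_source
    (fun _ => Topology.IsInducing.induced _)

instance : TopologicalSpace (TotalSpace (Fin k → Fin n → ℝ) p.Jet) :=
  p.jetPrebundle.totalSpaceTopology

instance : FiberBundle (Fin k → Fin n → ℝ) p.Jet :=
  p.jetPrebundle.toFiberBundle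

end SmoothFiberBundle

end Bundles

/-! ### Smooth affine bundles -/

/-- A fibre bundle `A → B` with typical fibre a vector space `W`, whose fibres `A b` are affine
spaces modelled on vector spaces `V b`, is a smooth affine bundle if its total space is a smooth
manifold and if around every point of `B` there is a smooth local trivialization which restricts
to an affine isomorphism `A b ≃ W` on each fibre. -/
structure IsSmoothAffineBundle (m : ℕ) {B : Type*} [TopologicalSpace B]
    [ChartedSpace (EuclideanSpace ℝ (Fin m)) B]
    (W : Type*) [NormedAddCommGroup W] [NormedSpace ℝ W] (V A : B → Type*)
    [∀ b, AddCommGroup (V b)] [∀ b, Module ℝ (V b)] [∀ b, AddTorsor (V b) (A b)]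
    [TopologicalSpace (TotalSpace W A)] [∀ b, TopologicalSpace (A b)] [FiberBundle W A] :
    Prop where
  isManifold : IsManifold ((𝓡 m).prod 𝓘(ℝ, W)) ∞ (TotalSpace W A)
  exists_trivialization (b : B) : ∃ t : Bundle.Trivialization W (π W A), b ∈ t.baseSet ∧
    ContMDiffOn ((𝓡 m).prod 𝓘(ℝ, W)) ((𝓡 m).prod 𝓘(ℝ, W)) ∞ t t.source ∧
    ContMDiffOn ((𝓡 m).prod 𝓘(ℝ, W)) ((𝓡 m).prod 𝓘(ℝ, W)) ∞
      t.toOpenPartialHomeomorph.symm t.target ∧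
    ∀ b' ∈ t.baseSet, ∃ α : A b' ≃ᵃ[ℝ] W, ∀ a : A b', t ⟨b', a⟩ = (b', α a)

/-- An isomorphism of smooth affine bundles over the identity of `B`: a family of affine
isomorphisms of the fibres such that the induced bijection of the total spaces is a
diffeomorphism. -/
structure SmoothAffineBundleEquiv (m : ℕ) {B : Type*} [TopologicalSpace B]
    [ChartedSpace (EuclideanSpace ℝ (Fin m)) B]
    (W : Type*) [NormedAddCommGroup W] [NormedSpace ℝ W] (V A V' A' : B → Type*)
    [∀ b, AddCommGroup (V b)] [∀ b, Module ℝ (V b)] [∀ b, AddTorsor (V b) (A b)]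
    [TopologicalSpace (TotalSpace W A)] [∀ b, TopologicalSpace (A b)] [FiberBundle W A]
    [∀ b, AddCommGroup (V' b)] [∀ b, Module ℝ (V' b)] [∀ b, AddTorsor (V' b) (A' b)]
    [TopologicalSpace (TotalSpace W A')] [∀ b, TopologicalSpace (A' b)] [FiberBundle W A'] where
  /-- The affine isomorphism of the fibres over `b`. -/
  fiberEquiv (b : B) : A b ≃ᵃ[ℝ] A' b
  contMDiff_toFun : ContMDiff ((𝓡 m).prod 𝓘(ℝ, W)) ((𝓡 m).prod 𝓘(ℝ, W)) ∞
    (fun a : TotalSpace W A => (⟨a.1, fiberEquiv a.1 a.2⟩ : TotalSpace W A'))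
  contMDiff_invFun : ContMDiff ((𝓡 m).prod 𝓘(ℝ, W)) ((𝓡 m).prod 𝓘(ℝ, W)) ∞
    (fun a : TotalSpace W A' => (⟨a.1, (fiberEquiv a.1).symm a.2⟩ : TotalSpace W A))

end

noncomputable section

/-!
In the coordinates `ξ ∈ ℝ^{kn}` of an adapted frame `u`, both the fibre of
`L_π E ×_{G_V} (G_V / H)` and the fibre of `J¹π` become `ℝ^{kn}`, and passing from `u` to the frame
`u g` changes `ξ` by the same affine map in the two cases. So the identity of `ℝ^{kn}`, read through
any frame, is an affine isomorphism of the fibres which does not depend on the frame, and in the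
local trivializations of the two bundles over `E` it is the identity again.

All smoothness questions reduce to that of the transition functions between two smooth local frames,
whose entries are the coefficients of the vector fields of one frame with respect to the other. The
inverse matrix `A⁻¹` in the coordinate change causes no trouble: it is the block `A` of the
opposite transition function.
-/

section LocalFrame

variable {𝕜 EB HB B F ι : Type*} [NontriviallyNormedField 𝕜]
  [NormedAddCommGroup EB] [NormedSpace 𝕜 EB] [TopologicalSpace HB] {IB : ModelWithCorners 𝕜 EB HB}
  [TopologicalSpace B] [ChartedSpace HB B] [NormedAddCommGroup F] [NormedSpace 𝕜 F]
  {V : B → Type*} [TopologicalSpace (TotalSpace F V)] [∀ x, TopologicalSpace (V x)]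
  [FiberBundle F V] [Fintype ι]
  {r : ℕ∞ω} {s : ι → (x : B) → V x} {u : Set B} {x : B}

variable (𝕜) in
/-- The linear map `c ↦ ∑ i, c i • s i x` attached to a family `s` of sections of a vector bundle,
read in a trivialization `t`. Its values lie in the model fibre, so that its dependence on `x` can
be studied as a map into a fixed normed space. -/
def frameMap (t : Trivialization F (π F V)) (s : ι → (x : B) → V x) (x : B) : (ι → 𝕜) →L[𝕜] F :=
  ∑ i, (ContinuousLinearMap.proj i : (ι → 𝕜) →L[𝕜] 𝕜).smulRight (t ⟨x, s i x⟩).2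

theorem contMDiffAt_frameMap (hs : ∀ i, CMDiffAt r (T% (s i)) x) :
    CMDiffAt r (frameMap 𝕜 (trivializationAt F V x) s) x := by
  unfold frameMap
  refine ContMDiffAt.sum fun i _ => ?_
  have hsi := (contMDiffAt_section x).1 (hs i)
  exact (ContinuousLinearMap.smulRightL 𝕜 (ι → 𝕜) F
    (ContinuousLinearMap.proj i)).contMDiff.contMDiffAt.comp x hsi

variable [∀ x, AddCommGroup (V x)] [∀ x, Module 𝕜 (V x)] [VectorBundle 𝕜 F V]

theorem frameMap_apply (t : Trivialization F (π F V)) [MemTrivializationAtlas t]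
    (ht : x ∈ t.baseSet) (c : ι → 𝕜) :
    frameMap 𝕜 t s x c = t.continuousLinearEquivAt 𝕜 x ht (∑ i, c i • s i x) := by
  simp [frameMap]

variable [CompleteSpace 𝕜]

theorem exists_frameMap_eq (hs : IsLocalFrameOn IB F r s u) (hu : x ∈ u)
    (t : Trivialization F (π F V)) [MemTrivializationAtlas t] (ht : x ∈ t.baseSet) :
    ∃ Φ : (ι → 𝕜) ≃L[𝕜] F, frameMap 𝕜 t s x = Φ := by
  refine ⟨((hs.toBasisAt hu).equivFun.symm.trans
    (t.continuousLinearEquivAt 𝕜 x ht).toLinearEquiv).toContinuousLinearEquiv, ?_⟩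
  ext1 c
  rw [frameMap_apply t ht]
  simp [Module.Basis.equivFun_symm_apply, -Trivialization.continuousLinearEquivAt_apply]

theorem inverse_frameMap_apply (hs : IsLocalFrameOn IB F r s u) (hu : x ∈ u)
    (t : Trivialization F (π F V)) [MemTrivializationAtlas t] (ht : x ∈ t.baseSet) (v : V x) :
    (frameMap 𝕜 t s x).inverse (t ⟨x, v⟩).2 = fun i => hs.coeff i x v := by
  obtain ⟨Φ, hΦ⟩ := exists_frameMap_eq hs hu t ht
  have hv : Φ (fun i => hs.coeff i x v) = (t ⟨x, v⟩).2 := by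
    rw [← ContinuousLinearEquiv.coe_coe, ← hΦ, frameMap_apply t ht]
    simp only [IsLocalFrameOn.coeff, dif_pos hu, Module.Basis.coord_apply,
      ← hs.toBasisAt_coe hu, Module.Basis.sum_repr]
    rfl
  rw [hΦ, ContinuousLinearMap.inverse_equiv, ← hv, ContinuousLinearEquiv.coe_coe,
    Φ.symm_apply_apply]

omit [Fintype ι] in
theorem contMDiffAt_coeff [Finite ι] (hs : IsLocalFrameOn IB F r s u) (hu : u ∈ nhds x)
    {σ : (x : B) → V x} (hσ : CMDiffAt r (T% σ) x) (i : ι) :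
    CMDiffAt r (fun y => hs.coeff i y (σ y)) x := by
  have := Fintype.ofFinite ι
  have hxt := FiberBundle.mem_baseSet_trivializationAt F V x
  obtain ⟨Φ, hΦ⟩ := exists_frameMap_eq hs (mem_of_mem_nhds hu) _ hxt
  have hinv : CMDiffAt r (fun y => (frameMap 𝕜 (trivializationAt F V x) s y).inverse) x :=
    ContMDiffAt.comp x (hΦ ▸ (contDiffAt_map_inverse Φ).contMDiffAt)
      (contMDiffAt_frameMap fun i => (hs.contMDiffOn i).contMDiffAt hu)
  have hcoeff := hinv.clm_apply ((contMDiffAt_section x).1 hσ)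
  refine (contMDiffAt_pi_space.1 hcoeff i).congr_of_eventuallyEq ?_
  filter_upwards [hu, (trivializationAt F V x).open_baseSet.mem_nhds hxt] with y hyu hyt
  exact (congrFun (inverse_frameMap_apply hs hyu _ hyt (σ y)) i).symm

end LocalFrame

section Pregroupoid

variable {𝕜 EX HX : Type*} [NontriviallyNormedField 𝕜] [NormedAddCommGroup EX] [NormedSpace 𝕜 EX]
  [TopologicalSpace HX] (I : ModelWithCorners 𝕜 EX HX) (r : ℕ∞ω)
  (X : Type*) [TopologicalSpace X] [ChartedSpace HX X]

/-- The pregroupoid of `C^r` maps between open subsets of a manifold `X`. It describes `C^r`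
structures on spaces that are charted on `X` rather than on the model of `X`. -/
def contMDiffPregroupoid : Pregroupoid X where
  property f s := CMDiff[s] r f
  comp hf hg _ _ _ := hg.comp' hf
  id_mem := contMDiffOn_id
  locality _ h x hx := by
    obtain ⟨v, hv, hxv, hf⟩ := h x hx
    exact (contMDiffWithinAt_inter (hv.mem_nhds hxv)).1 (hf x ⟨hx, hxv⟩)
  congr _ h hf := hf.congr h

end Pregroupoid

section FiberBundle

variable {r : ℕ∞ω} {𝕜 EB HB B W : Type*} {A : B → Type*} [NontriviallyNormedField 𝕜]
  [NormedAddCommGroup EB] [NormedSpace 𝕜 EB] [TopologicalSpace HB] {IB : ModelWithCorners 𝕜 EB HB}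
  [TopologicalSpace B] [ChartedSpace HB B] [NormedAddCommGroup W] [NormedSpace 𝕜 W]
  [TopologicalSpace (TotalSpace W A)] [∀ b, TopologicalSpace (A b)] [FiberBundle W A]

variable (r W A IB) in
/-- A fibre bundle, with typical fibre a normed space, is `C^r` if the coordinate changes between
the trivializations of its atlas are `C^r`. This is the analogue, without linearity of the fibres,
of `ContMDiffVectorBundle`. -/
class ContMDiffFiberBundle : Prop where
  contMDiffOn_coordChange : ∀ (t t' : Trivialization W (π W A)) [MemTrivializationAtlas t]
    [MemTrivializationAtlas t'], CMDiff[(t.baseSet ∩ t'.baseSet) ×ˢ Set.univ] r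
      (fun q : B × W => t.coordChange t' q.1 q.2)

namespace ContMDiffFiberBundle

variable (IB) [ContMDiffFiberBundle r W A IB] (t t' : Trivialization W (π W A))
  [MemTrivializationAtlas t] [MemTrivializationAtlas t']

theorem contMDiffAt_coordChange {q : B × W} (ht : q.1 ∈ t.baseSet) (ht' : q.1 ∈ t'.baseSet) :
    CMDiffAt r (fun q : B × W => t.coordChange t' q.1 q.2) q :=
  (contMDiffOn_coordChange t t').contMDiffAt
    (((t.open_baseSet.inter t'.open_baseSet).prod isOpen_univ).mem_nhds ⟨⟨ht, ht'⟩, trivial⟩)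

theorem contMDiffOn_symm_trans : ContMDiffOn (IB.prod 𝓘(𝕜, W)) (IB.prod 𝓘(𝕜, W)) r
    (t.toOpenPartialHomeomorph.symm.trans t'.toOpenPartialHomeomorph)
    (t.toOpenPartialHomeomorph.symm.trans t'.toOpenPartialHomeomorph).source := by
  have hsource : (t.toOpenPartialHomeomorph.symm.trans t'.toOpenPartialHomeomorph).source =
    (t.baseSet ∩ t'.baseSet) ×ˢ Set.univ := t.symm_trans_source_eq t'
  rw [hsource]
  refine (contMDiffOn_fst.prodMk (contMDiffOn_coordChange t t')).congr fun q hq => ?_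
  exact (t.mk_coordChange t' hq.1.1 hq.1.2 q.2).symm

variable (r W A) in
theorem isManifold_totalSpace [IsManifold IB r B] :
    IsManifold (IB.prod 𝓘(𝕜, W)) r (TotalSpace W A) := by
  have : HasGroupoid (TotalSpace W A)
      (contMDiffPregroupoid (IB.prod 𝓘(𝕜, W)) r (B × W)).groupoid :=
    hasGroupoid_of_pregroupoid _ <| by
      rintro _ _ ⟨t, ht, rfl⟩ ⟨t', ht', rfl⟩
      have : MemTrivializationAtlas t := ⟨ht⟩
      have : MemTrivializationAtlas t' := ⟨ht'⟩
      exact contMDiffOn_symm_trans IB t t'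
  exact { StructureGroupoid.HasGroupoid.comp
    (contMDiffPregroupoid (IB.prod 𝓘(𝕜, W)) r (B × W)).groupoid fun e he =>
      (isLocalStructomorphOn_contDiffGroupoid_iff e).2 he with }

theorem contMDiffOn_trivialization :
    ContMDiffOn (IB.prod 𝓘(𝕜, W)) (IB.prod 𝓘(𝕜, W)) r t t.source := by
  intro a ha
  let t₀ := trivializationAt W A a.1
  have hat₀ : a.1 ∈ t₀.baseSet := FiberBundle.mem_baseSet_trivializationAt W A a.1
  have ht₀ : CMDiffAt r (fun a' : TotalSpace W A => (a'.1, (t₀ a').2)) a :=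
    (contMDiffAt_totalSpace.1 contMDiffAt_id).1.prodMk (contMDiffAt_totalSpace.1 contMDiffAt_id).2
  have ht := ((contMDiffAt_proj A).prodMk ((contMDiffAt_coordChange IB t₀ t
    (q := (a.1, (t₀ a).2)) hat₀ (t.mem_source.1 ha)).comp a ht₀))
  refine (ht.congr_of_eventuallyEq ?_).contMDiffWithinAt
  filter_upwards [t₀.open_source.mem_nhds (t₀.mem_source.2 hat₀), t.open_source.mem_nhds ha] with
    a' h h'
  exact Prod.ext (t.coe_fst h') (t₀.coordChange_apply_snd t (t₀.mem_source.1 h)).symm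

theorem contMDiffOn_trivialization_symm :
    ContMDiffOn (IB.prod 𝓘(𝕜, W)) (IB.prod 𝓘(𝕜, W)) r t.toOpenPartialHomeomorph.symm t.target := by
  intro q hq
  have hproj := t.proj_symm_apply hq
  refine (contMDiffAt_totalSpace.2 ⟨contMDiffAt_fst.congr_of_eventuallyEq ?_,
    contMDiffAt_coordChange IB t _ (t.mem_target.1 hq) (Set.mem_of_eq_of_mem hproj.symm
      (FiberBundle.mem_baseSet_trivializationAt W A _))⟩).contMDiffWithinAt
  filter_upwards [t.open_target.mem_nhds hq] with q' hq'
  exact t.proj_symm_apply hq'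

end ContMDiffFiberBundle

theorem contMDiff_totalSpaceMap_of_trivializationAt_eq {A' : B → Type*}
    [TopologicalSpace (TotalSpace W A')] [∀ b, TopologicalSpace (A' b)] [FiberBundle W A']
    (f : ∀ b, A b → A' b)
    (hf : ∀ b b' (a : A b'), (trivializationAt W A' b ⟨b', f b' a⟩).2 =
      (trivializationAt W A b ⟨b', a⟩).2) :
    ContMDiff (IB.prod 𝓘(𝕜, W)) (IB.prod 𝓘(𝕜, W)) r
      (fun a : TotalSpace W A => (⟨a.1, f a.1 a.2⟩ : TotalSpace W A')) := by
  intro a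
  have hid := (contMDiffAt_totalSpace.1 (contMDiffAt_id (n := r) (I := IB.prod 𝓘(𝕜, W)) (x := a))).2
  refine contMDiffAt_totalSpace.2 ⟨contMDiffAt_proj A, ?_⟩
  exact hid.congr_of_eventuallyEq (.of_forall fun a' => hf a.1 a'.1 a'.2)

end FiberBundle

theorem isSmoothAffineBundle_of_affine_trivializationAt {m : ℕ} {B W : Type*} {V A : B → Type*}
    [TopologicalSpace B] [ChartedSpace (EuclideanSpace ℝ (Fin m)) B] [IsManifold (𝓡 m) ∞ B]
    [NormedAddCommGroup W] [NormedSpace ℝ W] [∀ b, AddCommGroup (V b)] [∀ b, Module ℝ (V b)]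
    [∀ b, AddTorsor (V b) (A b)] [TopologicalSpace (TotalSpace W A)] [∀ b, TopologicalSpace (A b)]
    [FiberBundle W A] [ContMDiffFiberBundle ∞ W A (𝓡 m)]
    (h : ∀ b, ∀ b' ∈ (trivializationAt W A b).baseSet,
      ∃ α : A b' ≃ᵃ[ℝ] W, ∀ a, trivializationAt W A b ⟨b', a⟩ = (b', α a)) :
    IsSmoothAffineBundle m W V A where
  isManifold := ContMDiffFiberBundle.isManifold_totalSpace ∞ W A (𝓡 m)
  exists_trivialization b := ⟨_, FiberBundle.mem_baseSet_trivializationAt W A b,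
    ContMDiffFiberBundle.contMDiffOn_trivialization (𝓡 m) _,
    ContMDiffFiberBundle.contMDiffOn_trivialization_symm (𝓡 m) _, h b⟩

namespace SmoothFiberBundle

variable {n k : ℕ} {M E F : Type*}
  [TopologicalSpace M] [ChartedSpace (EuclideanSpace ℝ (Fin n)) M]
  [TopologicalSpace E] [ChartedSpace (EuclideanSpace ℝ (Fin (n + k))) E]
  [TopologicalSpace F] [ChartedSpace (EuclideanSpace ℝ (Fin k)) F]
  {p : SmoothFiberBundle n k M E F}
  [IsManifold (𝓡 n) ∞ M] [IsManifold (𝓡 k) ∞ F]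

section Affine

variable {e : E}

/-- The coordinate `ξ ∈ ℝ^{kn}` of a class `[u, ξ]` of the associated bundle with respect to the
adapted frame `u`, as an affine isomorphism. -/
def Associated.affineCoord (u : p.AdaptedFrame e) :
    p.AssociatedHomogeneous e ≃ᵃ[ℝ] (Fin k → Fin n → ℝ) where
  toEquiv := (Associated.matrixCoord u).trans Matrix.of.symm
  linear := LinearEquiv.symm
    { toFun := fun v => Associated.mk u (Matrix.of v)
      map_add' := fun v w => Associated.mk_add u (Matrix.of v) (Matrix.of w)
      map_smul' := fun r v => Associated.mk_smul u r (Matrix.of v)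
      invFun := fun v => Matrix.of.symm (Associated.coord u v)
      left_inv := fun v => Associated.coord_mk u (Matrix.of v)
      right_inv := fun v => Associated.mk_coord u v }
  map_vadd' a v := by
    obtain ⟨x, rfl⟩ := (Associated.mk_bijective u).2 a
    obtain ⟨w, rfl⟩ := (Associated.mk_bijective u).2 v
    rw [← Associated.mk_vadd]
    change HomogeneousSpace.coord n k (Associated.coord u (Associated.mk u (w +ᵥ x))) =
      Associated.coord u (Associated.mk u w) +
        HomogeneousSpace.coord n k (Associated.coord u (Associated.mk u x))
    rw [Associated.coord_mk, Associated.coord_mk, Associated.coord_mk,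
      HomogeneousSpace.coord_vadd]

/-- The coordinates `ξ^A_i` of a jet `π_* e_i ↦ e_i + ξ^A_i e_A` with respect to the adapted frame
`(e_i, e_A)`, as an affine isomorphism. -/
def Jet.affineCoord (u : p.AdaptedFrame e) : p.Jet e ≃ᵃ[ℝ] (Fin k → Fin n → ℝ) :=
  AffineEquiv.ofBijective
    (φ :=
      { toFun := (Jet.matrixCoord u).trans Matrix.of.symm
        linear :=
          { toFun := fun σ A i =>
              u.basis.repr (σ.1 (p.tangentMapAt e (u.basis (Sum.inl i)))) (Sum.inr A)
            map_add' := fun σ σ' => by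
              ext A i
              exact DFunLike.congr_fun (map_add u.basis.repr _ _) (Sum.inr A)
            map_smul' := fun r σ => by
              ext A i
              exact DFunLike.congr_fun (map_smul u.basis.repr r _) (Sum.inr A) }
        map_vadd' := fun τ σ => by
          ext A i
          exact DFunLike.congr_fun (map_add u.basis.repr _ _) (Sum.inr A) })
    ((Jet.matrixCoord u).trans Matrix.of.symm).bijective

variable (p e) in
/-- The affine isomorphism between the fibres of `L_π E ×_{G_V} (G_V / H)` and `J¹π` over `e` which
is the identity in the coordinates of an adapted frame at `e`. The frame is arbitrary: see
`matrixCoord_jetEquiv`. -/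
def jetEquiv : p.AssociatedHomogeneous e ≃ᵃ[ℝ] p.Jet e :=
  (Associated.affineCoord (Classical.arbitrary (p.AdaptedFrame e))).trans
    (Jet.affineCoord (Classical.arbitrary (p.AdaptedFrame e))).symm

theorem matrixCoord_jetEquiv (u : p.AdaptedFrame e) (a : p.AssociatedHomogeneous e) :
    Jet.matrixCoord u (p.jetEquiv e a) = Associated.matrixCoord u a := by
  let u₀ := Classical.arbitrary (p.AdaptedFrame e)
  have h₀ : Jet.matrixCoord u₀ (p.jetEquiv e a) = Associated.matrixCoord u₀ a :=
    (Jet.affineCoord u₀).apply_symm_apply _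
  obtain ⟨g, hg⟩ := u.exists_act_eq u₀
  rw [Jet.matrixCoord_act u g, Associated.matrixCoord_act u g, ← hg, h₀]

theorem matrixCoord_jetEquiv_symm (u : p.AdaptedFrame e) (τ : p.Jet e) :
    Associated.matrixCoord u ((p.jetEquiv e).symm τ) = Jet.matrixCoord u τ := by
  rw [← matrixCoord_jetEquiv, AffineEquiv.apply_symm_apply]

theorem Associated.matrixCoord_mk_unip (u : p.AdaptedFrame e) (ξ : Matrix (Fin k) (Fin n) ℝ) :
    Associated.matrixCoord u (Associated.mk u (GV.unip ξ : HomogeneousSpace n k)) = ξ := by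
  change HomogeneousSpace.coord n k (Associated.coord u (Associated.mk u _)) = ξ
  rw [Associated.coord_mk]
  exact (HomogeneousSpace.coord n k).apply_symm_apply ξ

theorem jetEquiv_mk_unip_apply (u : p.AdaptedFrame e) (ξ : Matrix (Fin k) (Fin n) ℝ) (i : Fin n) :
    (p.jetEquiv e (Associated.mk u (GV.unip ξ : HomogeneousSpace n k))).toLin
        (p.tangentMapAt e (u.basis (Sum.inl i))) =
      u.basis (Sum.inl i) + ∑ A, ξ A i • u.basis (Sum.inr A) := by
  rw [Jet.apply_eq, matrixCoord_jetEquiv, Associated.matrixCoord_mk_unip]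

end Affine

variable [IsManifold (𝓡 (n + k)) ∞ E]

namespace LocalAdaptedFrame

variable (s s' : p.LocalAdaptedFrame)

theorem transition_apply {e : E} (hs : e ∈ s.domain) (hs' : e ∈ s'.domain) (α β : Fin n ⊕ Fin k) :
    (s.transition s' e).1.1 α β = s.isLocalFrameOn.coeff α e (s'.vec β e) := by
  have hbasis : (s.frameAt e).basis = s.isLocalFrameOn.toBasisAt hs := by rw [frameAt, dif_pos hs]
  rw [IsLocalFrameOn.coeff, dif_pos hs, ← hbasis, ← s'.frameAt_basis hs', ← s.act_transition s',
    AdaptedFrame.act_basis]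
  simp [Finsupp.single_apply, -Fintype.sum_sum_type]

theorem contMDiffAt_transition_apply {e : E} (hs : e ∈ s.domain) (hs' : e ∈ s'.domain)
    (α β : Fin n ⊕ Fin k) :
    ContMDiffAt (𝓡 (n + k)) 𝓘(ℝ) ∞ (fun e => (s.transition s' e).1.1 α β) e := by
  refine (contMDiffAt_coeff s.isLocalFrameOn (s.isOpen_domain.mem_nhds hs)
    (s'.isLocalFrameOn.contMDiffAt s'.isOpen_domain hs' β) α).congr_of_eventuallyEq ?_
  filter_upwards [s.isOpen_domain.mem_nhds hs, s'.isOpen_domain.mem_nhds hs'] with e he he'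
  exact s.transition_apply s' he he' α β

theorem transition_mul_transition (e : E) : s.transition s' e * s'.transition s e = 1 :=
  (s.frameAt e).act_injective <| by
    rw [AdaptedFrame.act_mul, act_transition, act_transition, AdaptedFrame.act_one]

theorem inv_A_transition (e : E) : (s.transition s' e).A⁻¹ = (s'.transition s e).A :=
  Matrix.inv_eq_right_inv <| by
    rw [← GV.A_mul, transition_mul_transition, GV.A_one]

/-- The matrix `ξ` of coordinates in the frame `s'` of the element with coordinates `q.2` in the
frame `s`, over the point `q.1`. -/
def coordChange (q : E × (Fin k → Fin n → ℝ)) : Fin k → Fin n → ℝ :=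
  Matrix.of.symm ((s'.transition s q.1).C * (s'.transition s q.1).A⁻¹ +
    (s'.transition s q.1).B * Matrix.of q.2 * (s'.transition s q.1).A⁻¹)

theorem contMDiffAt_coordChange {q : E × (Fin k → Fin n → ℝ)} (hs : q.1 ∈ s.domain)
    (hs' : q.1 ∈ s'.domain) :
    ContMDiffAt ((𝓡 (n + k)).prod 𝓘(ℝ, Fin k → Fin n → ℝ)) 𝓘(ℝ, Fin k → Fin n → ℝ) ∞
      (s.coordChange s') q := by
  have hT (α β : Fin n ⊕ Fin k) :
      ContMDiffAt ((𝓡 (n + k)).prod 𝓘(ℝ, Fin k → Fin n → ℝ)) 𝓘(ℝ) ∞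
        (fun r : E × (Fin k → Fin n → ℝ) => (s'.transition s r.1).1.1 α β) q :=
    (s'.contMDiffAt_transition_apply s hs' hs α β).comp q contMDiffAt_fst
  have hAinv (i j : Fin n) :
      ContMDiffAt ((𝓡 (n + k)).prod 𝓘(ℝ, Fin k → Fin n → ℝ)) 𝓘(ℝ) ∞
        (fun r : E × (Fin k → Fin n → ℝ) => (s'.transition s r.1).A⁻¹ i j) q := by
    simp only [inv_A_transition]
    exact (s.contMDiffAt_transition_apply s' hs hs' (.inl i) (.inl j)).comp q contMDiffAt_fst
  have hξ (B : Fin k) (i : Fin n) :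
      ContMDiffAt ((𝓡 (n + k)).prod 𝓘(ℝ, Fin k → Fin n → ℝ)) 𝓘(ℝ) ∞
        (fun r : E × (Fin k → Fin n → ℝ) => r.2 B i) q := by
    have hsnd := contMDiffAt_snd (I := 𝓡 (n + k)) (J := 𝓘(ℝ, Fin k → Fin n → ℝ)) (n := ∞) (p := q)
    exact contMDiffAt_pi_space.1 (contMDiffAt_pi_space.1 hsnd B) i
  refine contMDiffAt_pi_space.2 fun A => contMDiffAt_pi_space.2 fun i => ?_
  simp only [coordChange, Matrix.of_symm_apply, Matrix.add_apply, Matrix.mul_apply]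
  exact (ContMDiffAt.sum fun j _ => (hT (.inr A) (.inl j)).mul (hAinv j i)).add
    (ContMDiffAt.sum fun j _ => (ContMDiffAt.sum fun B _ =>
      (hT (.inr A) (.inr B)).mul (hξ B j)).mul (hAinv j i))

end LocalAdaptedFrame

section FrameTrivialization

variable {A : E → Type*} [TopologicalSpace (TotalSpace (Fin k → Fin n → ℝ) A)]
  {c : ∀ {e : E}, p.AdaptedFrame e → A e ≃ Matrix (Fin k) (Fin n) ℝ}
  {s s' : p.LocalAdaptedFrame} {t t' : Trivialization (Fin k → Fin n → ℝ) (π (Fin k → Fin n → ℝ) A)}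

theorem trivialization_coordChange_eq
    (hc : ∀ {e : E} (u : p.AdaptedFrame e) (g : GV n k) (a : A e),
      c u a = g.C * g.A⁻¹ + g.B * c (u.act g) a * g.A⁻¹)
    (ht : t.toPretrivialization = p.pretrivialization c s)
    (ht' : t'.toPretrivialization = p.pretrivialization c s')
    {e : E} (he : e ∈ s.domain) (ξ : Fin k → Fin n → ℝ) :
    t.coordChange t' e ξ = s.coordChange s' (e, ξ) := by
  let a : TotalSpace (Fin k → Fin n → ℝ) A := ⟨e, (c (s.frameAt e)).symm (Matrix.of ξ)⟩
  have hta : (t a).2 = ξ := by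
    change (t.toPretrivialization a).2 = ξ
    rw [ht]
    exact congrArg Matrix.of.symm ((c (s.frameAt e)).apply_symm_apply _)
  have hta' : (t' a).2 = Matrix.of.symm (c (s'.frameAt e) a.2) := by
    change (t'.toPretrivialization a).2 = _
    rw [ht']
    rfl
  have hbase : t.baseSet = s.domain := congrArg Pretrivialization.baseSet ht
  have hchange := t.coordChange_apply_snd t' (p := a) (hbase ▸ he)
  rw [hta, hta', hc _ (s'.transition s e), s'.act_transition s, Equiv.apply_symm_apply] at hchange
  exact hchange

theorem contMDiffFiberBundle_of_pretrivialization [∀ e, TopologicalSpace (A e)]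
    [FiberBundle (Fin k → Fin n → ℝ) A]
    (hc : ∀ {e : E} (u : p.AdaptedFrame e) (g : GV n k) (a : A e),
      c u a = g.C * g.A⁻¹ + g.B * c (u.act g) a * g.A⁻¹)
    (hA : ∀ t ∈ FiberBundle.trivializationAtlas (Fin k → Fin n → ℝ) A,
      ∃ s, t.toPretrivialization = p.pretrivialization c s) :
    ContMDiffFiberBundle ∞ (Fin k → Fin n → ℝ) A (𝓡 (n + k)) where
  contMDiffOn_coordChange t t' ht ht' := by
    obtain ⟨s, hs⟩ := hA t ht.out
    obtain ⟨s', hs'⟩ := hA t' ht'.out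
    have hbase : t.baseSet = s.domain := congrArg Pretrivialization.baseSet hs
    have hbase' : t'.baseSet = s'.domain := congrArg Pretrivialization.baseSet hs'
    rw [hbase, hbase']
    have hsmooth : ContMDiffOn ((𝓡 (n + k)).prod 𝓘(ℝ, Fin k → Fin n → ℝ))
        𝓘(ℝ, Fin k → Fin n → ℝ) ∞ (s.coordChange s') ((s.domain ∩ s'.domain) ×ˢ Set.univ) :=
      fun q hq => (s.contMDiffAt_coordChange s' hq.1.1 hq.1.2).contMDiffWithinAt
    exact hsmooth.congr fun q hq => trivialization_coordChange_eq hc hs hs' hq.1.1 q.2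

end FrameTrivialization

instance : ContMDiffFiberBundle ∞ (Fin k → Fin n → ℝ) p.AssociatedHomogeneous (𝓡 (n + k)) :=
  contMDiffFiberBundle_of_pretrivialization Associated.matrixCoord_act <| by
    rintro _ ⟨_, ⟨s, rfl⟩, rfl⟩
    exact ⟨s, rfl⟩

instance : ContMDiffFiberBundle ∞ (Fin k → Fin n → ℝ) p.Jet (𝓡 (n + k)) :=
  contMDiffFiberBundle_of_pretrivialization Jet.matrixCoord_act <| by
    rintro _ ⟨_, ⟨c, rfl⟩, rfl⟩
    exact ⟨c.frame, rfl⟩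

variable (p)

theorem trivializationAt_associatedHomogeneous_apply (e e' : E) (a : p.AssociatedHomogeneous e') :
    trivializationAt (Fin k → Fin n → ℝ) p.AssociatedHomogeneous e ⟨e', a⟩ =
      (e', Associated.affineCoord ((p.adaptedChartAt e).frame.frameAt e') a) :=
  rfl

theorem trivializationAt_jet_apply (e e' : E) (τ : p.Jet e') :
    trivializationAt (Fin k → Fin n → ℝ) p.Jet e ⟨e', τ⟩ =
      (e', Jet.affineCoord ((p.adaptedChartAt e).frame.frameAt e') τ) :=
  rfl

theorem isSmoothAffineBundle_associatedHomogeneous :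
    IsSmoothAffineBundle (n + k) (Fin k → Fin n → ℝ)
      (fun e : E => p.AssociatedDirection e) (fun e : E => p.AssociatedHomogeneous e) :=
  isSmoothAffineBundle_of_affine_trivializationAt fun e _ _ =>
    ⟨_, p.trivializationAt_associatedHomogeneous_apply e _⟩

theorem isSmoothAffineBundle_jet :
    IsSmoothAffineBundle (n + k) (Fin k → Fin n → ℝ)
      (fun e : E => p.JetDirection e) (fun e : E => p.Jet e) :=
  isSmoothAffineBundle_of_affine_trivializationAt fun e _ _ =>
    ⟨_, p.trivializationAt_jet_apply e _⟩

/-- The isomorphism of smooth affine bundles `L_π E ×_{G_V} (G_V / H) ≅ J¹π` given by `jetEquiv` on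
the fibres. -/
def jetBundleEquiv : SmoothAffineBundleEquiv (n + k) (Fin k → Fin n → ℝ)
    (fun e : E => p.AssociatedDirection e) (fun e : E => p.AssociatedHomogeneous e)
    (fun e : E => p.JetDirection e) (fun e : E => p.Jet e) where
  fiberEquiv := p.jetEquiv
  contMDiff_toFun := contMDiff_totalSpaceMap_of_trivializationAt_eq (fun e => p.jetEquiv e)
    fun _ _ a => by
      rw [trivializationAt_associatedHomogeneous_apply, trivializationAt_jet_apply]
      exact congrArg Matrix.of.symm (matrixCoord_jetEquiv _ a)
  contMDiff_invFun := contMDiff_totalSpaceMap_of_trivializationAt_eq (fun e => (p.jetEquiv e).symm)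
    fun _ _ τ => by
      rw [trivializationAt_associatedHomogeneous_apply, trivializationAt_jet_apply]
      exact congrArg Matrix.of.symm (matrixCoord_jetEquiv_symm _ τ)

end SmoothFiberBundle

end

theorem mainTheorem1 {n k : ℕ} {M E F : Type*}
    [TopologicalSpace M] [ChartedSpace (EuclideanSpace ℝ (Fin n)) M] [IsManifold (𝓡 n) ∞ M]
    [TopologicalSpace E] [ChartedSpace (EuclideanSpace ℝ (Fin (n + k))) E]
    [IsManifold (𝓡 (n + k)) ∞ E]
    [TopologicalSpace F] [ChartedSpace (EuclideanSpace ℝ (Fin k)) F] [IsManifold (𝓡 k) ∞ F]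
    (p : SmoothFiberBundle n k M E F) :
    IsSmoothAffineBundle (n + k) (Fin k → Fin n → ℝ)
      (fun e : E => p.AssociatedDirection e) (fun e : E => p.AssociatedHomogeneous e) ∧
    IsSmoothAffineBundle (n + k) (Fin k → Fin n → ℝ)
      (fun e : E => p.JetDirection e) (fun e : E => p.Jet e) ∧
    ∃ Φ : SmoothAffineBundleEquiv (n + k) (Fin k → Fin n → ℝ)
        (fun e : E => p.AssociatedDirection e) (fun e : E => p.AssociatedHomogeneous e)
        (fun e : E => p.JetDirection e) (fun e : E => p.Jet e),
      ∀ (e : E) (u : p.AdaptedFrame e) (ξ : Matrix (Fin k) (Fin n) ℝ) (i : Fin n),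
        (Φ.fiberEquiv e
            (SmoothFiberBundle.Associated.mk u (GV.unip ξ : HomogeneousSpace n k))).toLin
          (p.tangentMapAt e (u.basis (Sum.inl i))) =
        u.basis (Sum.inl i) + ∑ A, ξ A i • u.basis (Sum.inr A) :=
  ⟨p.isSmoothAffineBundle_associatedHomogeneous, p.isSmoothAffineBundle_jet, p.jetBundleEquiv,
    fun _ => SmoothFiberBundle.jetEquiv_mk_unip_apply⟩
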